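/- Let $(X_j)_{j\ge 1}$ be i.i.d. $\mathbb{Z}$-valued random variables whose common probability mass function $p(u)=\mathbb{P}(X_1=u)$ has finite support, with $\mathbb{P}(X_1=0)<1$. Write $\mu=\mathbb{E}[X_1]$ and $\sigma^2=\mathbb{E}[X_1^2]$. Consider the infinite color urn model with colors indexed by $\mathbb{Z}$: the initial configuration is $U_0=\delta_0$ (that is, $U_{0,0}=1$ and $U_{0,v}=0$ for $v\ne 0$); given $U_0,\dots,U_n$, the $(n+1)$-st selected color $Z_n$ satisfies $$\mathbb{P}(Z_n=v\mid U_n,\dots,U_0)=\frac{U_{n,v}}{n+1},\qquad v\in\mathbb{Z},$$ and then $U_{n+1,v}=U_{n,v}+p(v-Z_n)$ for all $v\in\mathbb{Z}$. For $n\ge1$ put $h_n=\sum_{j=1}^n\frac1{j+1}$, $$\rho_2=\frac1n\Big(\sigma^2h_n-\mu^2\sum_{j=1}^n\frac1{(j+1)^2}\Big),\qquad \rho_3=\frac1n\Big(\sum_{j=1}^n\frac1{j+1}\,\mathbb{E}\Big[\Big|X_1-\frac{\mu}{j+1}\Big|^3\Big]+|\mu|^3\sum_{j=1}^n\frac{j}{(j+1)^4}\Big),$$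 and let $\Phi$ be the standard normal distribution function. Then for every $n\ge1$ $$\sup_{x\in\mathbb{R}}\left|\mathbb{P}\left(\frac{Z_n-\mu h_n}{\sqrt{n\rho_2}}\le x\right)-\Phi(x)\right|\le 2.75\,\frac{\rho_3}{\sqrt n\,\rho_2^{3/2}},$$ and, as $n\to\infty$, $$2.75\,\frac{\rho_3}{\sqrt n\,\rho_2^{3/2}}=\mathcal{O}\left(\frac1{\sqrt{\log n}}\right),$$ where the implied constant may depend on $p$. -/

import Mathlib

open MeasureTheory ProbabilityTheory Filter Asymptotics

namespace ColorUrn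

noncomputable section

/-- The information carried by the urn configurations `U 0, …, U n`. -/
abbrev history {Ω : Type*} (U : ℕ → Ω → ℤ → ℝ) (n : ℕ) : MeasurableSpace Ω :=
  ⨆ k ≤ n, MeasurableSpace.comap (U k) inferInstance

/-- The infinite color urn model with colors indexed by `ℤ`, associated with the random walk on `ℤ`
with increment distribution `p`, and started from the configuration `U₀`.
`U n ω v` is the weight of color `v` at time `n`, and `Z n ω` is the `(n+1)`-st selected color.
After color `V = Z n` is selected, the row `R_V = (p (v - V))_v` of the transition matrix of the
random walk is added to the configuration. The total weight of `U n` is `n + 1`, so that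
selecting a color with probability proportional to its weight means probability
`U n v / (n + 1)`, given the configurations up to time `n`. -/
structure IsUrn {Ω : Type*} [MeasurableSpace Ω] (P : Measure Ω) (p U₀ : PMF ℤ)
    (U : ℕ → Ω → ℤ → ℝ) (Z : ℕ → Ω → ℤ) : Prop where
  measurable_color : ∀ n, Measurable (Z n)
  init : ∀ ω v, U 0 ω v = (U₀ v).toReal
  step : ∀ n ω v, U (n + 1) ω v = U n ω v + (p (v - Z n ω)).toReal
  select : ∀ n v, P[(Z n ⁻¹' {v}).indicator (fun _ => (1 : ℝ)) | history U n]
    =ᵐ[P] fun ω => U n ω v / ((n : ℝ) + 1)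

/-- `μ = E[X₁]`, where `X₁` has probability mass function `p`. -/
def mean (p : PMF ℤ) : ℝ := ∫ x : ℤ, (x : ℝ) ∂p.toMeasure

/-- `σ² = E[X₁²]` (the one-dimensional case of `Σ = E[X₁ᵀ X₁]`). -/
def sigmaSq (p : PMF ℤ) : ℝ := ∫ x : ℤ, (x : ℝ) ^ 2 ∂p.toMeasure

/-- `h_n = ∑_{j=1}^n 1/(j+1)`. -/
def h (n : ℕ) : ℝ := ∑ j ∈ Finset.Icc 1 n, 1 / ((j : ℝ) + 1)

/-- `ρ₂ = (1/n) (σ² h_n - μ² ∑_{j=1}^n 1/(j+1)²)`. -/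
def rho2 (p : PMF ℤ) (n : ℕ) : ℝ :=
  1 / (n : ℝ) * (sigmaSq p * h n - mean p ^ 2 * ∑ j ∈ Finset.Icc 1 n, 1 / ((j : ℝ) + 1) ^ 2)

/-- `ρ₃ = (1/n) (∑_{j=1}^n (1/(j+1)) E|X₁ - μ/(j+1)|³ + |μ|³ ∑_{j=1}^n j/(j+1)⁴)`. -/
def rho3 (p : PMF ℤ) (n : ℕ) : ℝ :=
  1 / (n : ℝ) *
    (∑ j ∈ Finset.Icc 1 n,
        1 / ((j : ℝ) + 1) * ∫ x : ℤ, |(x : ℝ) - mean p / ((j : ℝ) + 1)| ^ 3 ∂p.toMeasure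
      + |mean p| ^ 3 * ∑ j ∈ Finset.Icc 1 n, (j : ℝ) / ((j : ℝ) + 1) ^ 4)

end

end ColorUrn

/-! Selecting a color proportionally to its weight gives E[U_{n,v}] = (n+1) P(Z_n = v). Taking
expectations in the urn recursion yields (n+2) P(Z_{n+1} = v) = (n+1) P(Z_n = v) + E[p(v - Z_n)].
Thus Z_{n+1} has the law of Z_n plus an independent step that equals X with probability 1/(n+2) and
0 otherwise (`IsUrn.map_color_succ`). Hence Z_n is distributed as the sum over 1 ≤ j ≤ n of
independent lazy steps with success probability 1/(j+1) (`IsUrn.map_color_eq`). This sum has mean μ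
h_n, variance n ρ₂ and third absolute central moment sum n ρ₃, so the first claim is a Berry–Esseen
bound for independent, non-identical summands.

That bound is proved with constant 2.75 in two regimes (`berry_esseen_sum`). With at most 25
summands the Lyapunov ratio is at least 1/5, and 2.75/5 = 0.55 exceeds the distance of any
standardized law to the normal law, by Cantelli's inequality
(`abs_measureReal_Iic_sub_gaussian_le`). For n > 25, h_n ≥ 2.8 and no step carries more than 18
percent of the variance; then a Fourier argument works (`berry_esseen_of_variance_le`). It combines
a smoothing inequality (`abs_measureReal_Iic_sub_le`) with a Taylor comparison of characteristic
functions (`norm_prod_charFun_sub_le`).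

The smoothing inequality comes from Beurling–Selberg majorants and minorants of the Heaviside
function. They have compactly supported Fourier transform, so integrating them only involves
characteristic functions at bounded frequencies, and their L¹ error against a bounded density is
explicit.

The rate follows since the variance is at least h_n σ²/2, the third moments sum to O(h_n), and h_n ≥
(log n)/2 for large n. -/

namespace ColorUrn

/-! ### Beurling's band-limited approximation of the sign function. -/

section BeurlingSelberg

open Real

lemma mul_cos_le_sin {x : ℝ} (h0 : 0 ≤ x) (hπ : x ≤ π) : x * cos x ≤ sin x := by
  rcases lt_or_ge x (π / 2) with h | h
  · rcases h0.eq_or_lt with rfl | h0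
    · simp
    have hc : 0 < cos x := cos_pos_of_mem_Ioo ⟨by linarith, h⟩
    have := lt_tan h0 h
    rw [tan_eq_sin_div_cos, lt_div_iff₀ hc] at this
    exact this.le
  · have hc : cos x ≤ 0 := cos_nonpos_of_pi_div_two_le_of_le h (by linarith [pi_pos])
    exact (mul_nonpos_of_nonneg_of_nonpos h0 hc).trans (sin_nonneg_of_nonneg_of_le_pi h0 hπ)

lemma two_mul_mul_one_sub_le_sin_pi {t : ℝ} (h0 : 0 ≤ t) (h1 : t ≤ 1) :
    2 * t * (1 - t) ≤ sin (π * t) := by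
  have hπ := pi_pos
  rcases le_total t (1 / 2) with h | h
  · have := mul_le_sin (x := π * t) (by positivity) (by nlinarith)
    have e : 2 / π * (π * t) = 2 * t := by field_simp
    nlinarith
  · have := mul_le_sin (x := π * (1 - t)) (mul_nonneg hπ.le (by linarith)) (by nlinarith)
    have e : 2 / π * (π * (1 - t)) = 2 * (1 - t) := by field_simp
    have e' : sin (π * (1 - t)) = sin (π * t) := by rw [mul_sub, mul_one, sin_pi_sub]
    nlinarith

lemma sin_pi_mul_pos {t : ℝ} (h0 : 0 < t) (h1 : t < 1) : 0 < sin (π * t) :=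
  sin_pos_of_pos_of_lt_pi (by positivity) (by nlinarith [pi_pos])

lemma intervalIntegrable_of_bound {g : ℝ → ℝ} {C : ℝ} (hg : Measurable g)
    (hC : ∀ t, 0 < t → t < 1 → |g t| ≤ C) : IntervalIntegrable g volume 0 1 := by
  rw [intervalIntegrable_iff_integrableOn_Ioo_of_le zero_le_one]
  exact Measure.integrableOn_of_bounded (by simp) hg.aestronglyMeasurable
    ((ae_restrict_iff' measurableSet_Ioo).2 (.of_forall fun t ht => hC t ht.1 ht.2))

lemma intervalIntegral_congr_Ioo {f g : ℝ → ℝ} (h : ∀ t, 0 < t → t < 1 → f t = g t) :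
    ∫ t in (0 : ℝ)..1, f t = ∫ t in (0 : ℝ)..1, g t := by
  rw [intervalIntegral.integral_of_le zero_le_one, intervalIntegral.integral_of_le zero_le_one,
    integral_Ioc_eq_integral_Ioo, integral_Ioc_eq_integral_Ioo]
  exact setIntegral_congr_fun measurableSet_Ioo fun t ht => h t ht.1 ht.2

/-- A factor which vanishes at `0` to first order, divided by the sine, stays bounded. -/
lemma abs_mul_div_sin_le {a C t : ℝ} (h0 : 0 < t) (h1 : t < 1) (ha : |a| ≤ C * t) :
    |(1 - t) * a / sin (π * t)| ≤ C := by
  have hs := sin_pi_mul_pos h0 h1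
  have h2 := two_mul_mul_one_sub_le_sin_pi h0.le h1.le
  have hC : 0 ≤ C := by
    by_contra hC
    nlinarith [abs_nonneg a]
  rw [abs_div, abs_mul, abs_of_pos hs, abs_of_pos (by linarith : 0 < 1 - t), div_le_iff₀ hs]
  have h3 : (1 - t) * |a| ≤ (1 - t) * (C * t) :=
    mul_le_mul_of_nonneg_left ha (by linarith)
  have h4 : 0 ≤ (1 - t) * t := mul_nonneg (by linarith) h0.le
  nlinarith [mul_le_mul_of_nonneg_left h2 hC, mul_nonneg hC h4]

/-- Riemann–Lebesgue along the half-integer frequencies N + 1/2; cosine and sine are the real and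
negated imaginary parts of one Fourier integral. -/
lemma tendsto_integral_mul_cos_sin {g : ℝ → ℝ} (hg : IntervalIntegrable g volume 0 1) :
    Tendsto (fun N : ℕ => ∫ t in (0 : ℝ)..1, g t * cos ((2 * N + 1) * (π * t))) atTop (nhds 0) ∧
    Tendsto (fun N : ℕ => ∫ t in (0 : ℝ)..1, g t * sin ((2 * N + 1) * (π * t))) atTop (nhds 0) := by
  have hw : Tendsto (fun N : ℕ => (N : ℝ) + 1 / 2) atTop (cocompact ℝ) :=
    (tendsto_atTop_add_const_right _ _ tendsto_natCast_atTop_atTop).mono_right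
      atTop_le_cocompact
  have key := (Real.tendsto_integral_exp_smul_cocompact
    (Set.indicator (Set.Ioc (0 : ℝ) 1) (fun t => (g t : ℂ)))).comp hw
  have hgi : IntegrableOn g (Set.Ioc 0 1) := by
    rwa [intervalIntegrable_iff_integrableOn_Ioc_of_le zero_le_one] at hg
  have hform : ∀ N : ℕ, ∀ t : ℝ, (Real.fourierChar (-(t * ((N : ℝ) + 1 / 2))) : ℂ) * (g t : ℂ) =
      ((g t * cos ((2 * N + 1) * (π * t)) : ℝ) : ℂ)
        - ((g t * sin ((2 * N + 1) * (π * t)) : ℝ) : ℂ) * Complex.I := by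
    intro N t
    rw [Real.fourierChar_apply]
    have : 2 * π * -(t * ((N : ℝ) + 1 / 2)) = -((2 * N + 1) * (π * t)) := by ring
    rw [this, Complex.exp_mul_I, ← Complex.ofReal_cos, ← Complex.ofReal_sin, cos_neg, sin_neg]
    push_cast
    ring
  have hc : ∀ N : ℕ, IntegrableOn (fun t => g t * cos ((2 * N + 1) * (π * t))) (Set.Ioc 0 1) := by
    intro N
    exact hgi.mul_bdd (c := 1) (by fun_prop) (.of_forall fun t => by simpa using abs_cos_le_one _)
  have hs : ∀ N : ℕ, IntegrableOn (fun t => g t * sin ((2 * N + 1) * (π * t))) (Set.Ioc 0 1) := by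
    intro N
    exact hgi.mul_bdd (c := 1) (by fun_prop) (.of_forall fun t => by simpa using abs_sin_le_one _)
  have hval : ∀ N : ℕ, (∫ v : ℝ, Real.fourierChar (-(v * ((N : ℝ) + 1 / 2))) •
      (Set.indicator (Set.Ioc (0 : ℝ) 1) (fun t => (g t : ℂ))) v) =
      ((∫ t in (0 : ℝ)..1, g t * cos ((2 * N + 1) * (π * t)) : ℝ) : ℂ)
        - ((∫ t in (0 : ℝ)..1, g t * sin ((2 * N + 1) * (π * t)) : ℝ) : ℂ) * Complex.I := by
    intro N
    rw [intervalIntegral.integral_of_le zero_le_one, intervalIntegral.integral_of_le zero_le_one,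
      ← integral_complex_ofReal, ← integral_complex_ofReal, ← integral_mul_const,
      ← integral_sub (hc N).ofReal ((hs N).ofReal.mul_const _), ← integral_indicator measurableSet_Ioc]
    congr 1
    ext v
    by_cases hv : v ∈ Set.Ioc (0 : ℝ) 1
    · simp only [Set.indicator_of_mem hv, Circle.smul_def, smul_eq_mul]
      exact hform N v
    · simp [Set.indicator_of_notMem hv]
  have key2 : Tendsto (fun N : ℕ =>
      ((∫ t in (0 : ℝ)..1, g t * cos ((2 * N + 1) * (π * t)) : ℝ) : ℂ)
        - ((∫ t in (0 : ℝ)..1, g t * sin ((2 * N + 1) * (π * t)) : ℝ) : ℂ) * Complex.I)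
      atTop (nhds 0) := by
    refine key.congr fun N => ?_
    exact hval N
  constructor
  · simpa [Function.comp_def] using (Complex.continuous_re.tendsto _).comp key2
  · have := ((Complex.continuous_im.tendsto _).comp key2).neg
    simpa [Function.comp_def] using this

lemma sum_cos_dirichlet (N : ℕ) (x : ℝ) :
    sin x * (1 + 2 * ∑ n ∈ Finset.range N, cos (2 * x * (n + 1))) = sin ((2 * N + 1) * x) := by
  induction N with
  | zero => simp
  | succ N ih =>
    rw [Finset.sum_range_succ, mul_add 2, ← add_assoc, mul_add, ih]
    have e1 : (2 * (N : ℝ) + 1) * x = 2 * x * (N + 1) - x := by ring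
    have e2 : (2 * ((N + 1 : ℕ) : ℝ) + 1) * x = 2 * x * (N + 1) + x := by push_cast; ring
    rw [e1, e2, sin_sub, sin_add]
    ring_nf

lemma sum_sin_dirichlet (N : ℕ) (x : ℝ) :
    sin x * (2 * ∑ n ∈ Finset.range N, sin (2 * x * (n + 1))) = cos x - cos ((2 * N + 1) * x) := by
  induction N with
  | zero => simp
  | succ N ih =>
    rw [Finset.sum_range_succ, mul_add, mul_add, ih]
    have e1 : (2 * (N : ℝ) + 1) * x = 2 * x * (N + 1) - x := by ring
    have e2 : (2 * ((N + 1 : ℕ) : ℝ) + 1) * x = 2 * x * (N + 1) + x := by push_cast; ring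
    rw [e1, e2, cos_sub, cos_add]
    ring

/-- The Fejér kernel `(sin (π x) / (π x)) ^ 2`, as the cosine transform of the triangle function. -/
noncomputable def fejer (x : ℝ) : ℝ := ∫ t in (0 : ℝ)..1, 2 * (1 - t) * cos (2 * (π * t) * x)

/-- The weight `(1 - t) cot (π t) + 1 / π`. -/
noncomputable def beurlingWeight (t : ℝ) : ℝ := (1 - t) * (cos (π * t) / sin (π * t)) + 1 / π

/-- Beurling's odd approximation of the sign function, of exponential type `2 π`. -/
noncomputable def beurling (x : ℝ) : ℝ :=
  ∫ t in (0 : ℝ)..1, 2 * beurlingWeight t * sin (2 * (π * t) * x)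

/-- This is y cos y ≤ sin y at y = π(1 - t), divided by π sin(πt). -/
lemma beurlingWeight_nonneg {t : ℝ} (h0 : 0 < t) (h1 : t < 1) : 0 ≤ beurlingWeight t := by
  have hs := sin_pi_mul_pos h0 h1
  have hπ := pi_pos
  have h := mul_cos_le_sin (x := π * (1 - t)) (mul_nonneg hπ.le (by linarith)) (by nlinarith)
  rw [show π * (1 - t) = π - π * t by ring, cos_pi_sub, sin_pi_sub] at h
  have e : beurlingWeight t = (sin (π * t) - (π - π * t) * -cos (π * t)) / (π * sin (π * t)) := by
    unfold beurlingWeight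
    rw [mul_div_assoc', div_add_div _ _ hs.ne' hπ.ne', div_eq_div_iff (by positivity) (by positivity)]
    ring
  rw [e]
  exact div_nonneg (by linarith) (by positivity)

lemma beurlingWeight_le {t : ℝ} (h0 : 0 < t) (h1 : t < 1) : beurlingWeight t ≤ 1 / (π * t) := by
  have hs := sin_pi_mul_pos h0 h1
  have hπ := pi_pos
  have h := mul_cos_le_sin (x := π * t) (by positivity) (by nlinarith)
  have h2 : cos (π * t) / sin (π * t) ≤ 1 / (π * t) := by
    rw [div_le_div_iff₀ hs (by positivity)]
    linarith
  have h3 := mul_le_mul_of_nonneg_left h2 (by linarith : 0 ≤ 1 - t)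
  have e : (1 - t) * (1 / (π * t)) + 1 / π = 1 / (π * t) := by
    field_simp
    ring
  unfold beurlingWeight
  linarith

@[fun_prop]
lemma measurable_beurlingWeight : Measurable beurlingWeight := by
  unfold beurlingWeight
  fun_prop

/-- The weight blows up like 1/(πt) at 0, and the zero of the sine there compensates. -/
lemma abs_beurlingWeight_mul_sin_le {t : ℝ} (h0 : 0 < t) (h1 : t < 1) (x : ℝ) :
    |2 * beurlingWeight t * sin (2 * (π * t) * x)| ≤ 4 * |x| := by
  have hπ := pi_pos
  have hw := beurlingWeight_nonneg h0 h1
  have h2 : |sin (2 * (π * t) * x)| ≤ 2 * (π * t) * |x| := by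
    refine abs_sin_le_abs.trans (le_of_eq ?_)
    rw [abs_mul, abs_of_pos (by positivity)]
  rw [abs_mul, abs_of_nonneg (by positivity)]
  calc 2 * beurlingWeight t * |sin (2 * (π * t) * x)|
      ≤ 2 * (1 / (π * t)) * (2 * (π * t) * |x|) := by
        gcongr
        exact beurlingWeight_le h0 h1
    _ = 4 * |x| := by field_simp; ring

lemma intervalIntegrable_beurling (x : ℝ) :
    IntervalIntegrable (fun t => 2 * beurlingWeight t * sin (2 * (π * t) * x)) volume 0 1 :=
  intervalIntegrable_of_bound (by fun_prop) fun _ h0 h1 => abs_beurlingWeight_mul_sin_le h0 h1 x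

lemma fejer_zero : fejer 0 = 1 := by
  unfold fejer
  simp only [mul_zero, cos_zero, mul_one]
  rw [intervalIntegral.integral_const_mul,
    intervalIntegral.integral_sub (by simp) (by simp)]
  simp
  norm_num

lemma fejer_eq {x : ℝ} (hx : x ≠ 0) : fejer x = sin (π * x) ^ 2 / (π * x) ^ 2 := by
  have hπ := pi_pos
  have hd : ∀ t ∈ Set.uIcc (0 : ℝ) 1, HasDerivAt
      (fun t => 2 * (1 - t) * (sin (2 * (π * t) * x) / (2 * π * x))
        - 2 * cos (2 * (π * t) * x) / (2 * π * x) ^ 2) (2 * (1 - t) * cos (2 * (π * t) * x)) t := by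
    intro t _
    have h1 : HasDerivAt (fun t : ℝ => 2 * (π * t) * x) (2 * π * x) t := by
      have := ((hasDerivAt_id t).const_mul (2 * π)).mul_const x
      simp only [id] at this
      convert! this using 1
      · ext; ring
      · ring
    have h2 : HasDerivAt (fun t : ℝ => 2 * (1 - t)) (-2) t := by
      have := ((hasDerivAt_id t).const_sub 1).const_mul 2
      simpa using this
    have h3 := (h2.mul (h1.sin.div_const (2 * π * x))).sub
      ((h1.cos.const_mul 2).div_const ((2 * π * x) ^ 2))
    refine h3.congr_deriv ?_
    field_simp
    ring
  unfold fejer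
  rw [intervalIntegral.integral_eq_sub_of_hasDerivAt hd (Continuous.intervalIntegrable (by fun_prop) _ _)]
  have e : cos (2 * (π * 1) * x) = 1 - 2 * sin (π * x) ^ 2 := by
    rw [show 2 * (π * 1) * x = 2 * (π * x) by ring, cos_two_mul, cos_sq']
    ring
  rw [e]
  simp
  field_simp
  ring

lemma fejer_nonneg (x : ℝ) : 0 ≤ fejer x := by
  rcases eq_or_ne x 0 with rfl | hx
  · simp [fejer_zero]
  · rw [fejer_eq hx]; positivity

lemma fejer_neg (x : ℝ) : fejer (-x) = fejer x := by simp [fejer]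

lemma beurling_neg (x : ℝ) : beurling (-x) = -beurling x := by simp [beurling]

lemma beurling_zero : beurling 0 = 0 := by simp [beurling]

lemma fejer_natCast_add_one (n : ℕ) : fejer ((n : ℝ) + 1) = 0 := by
  rw [fejer_eq (by positivity)]
  have : sin (π * ((n : ℝ) + 1)) = 0 := by
    have := sin_nat_mul_pi (n + 1)
    rw [mul_comm]
    exact_mod_cast this
  simp [this]

lemma integral_sin_two_pi {x : ℝ} (hx : x ≠ 0) :
    ∫ t in (0 : ℝ)..1, sin (2 * (π * t) * x) = sin (π * x) ^ 2 / (π * x) := by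
  have hπ := pi_pos
  have hd : ∀ t ∈ Set.uIcc (0 : ℝ) 1, HasDerivAt
      (fun t => - cos (2 * (π * t) * x) / (2 * π * x)) (sin (2 * (π * t) * x)) t := by
    intro t _
    have h1 : HasDerivAt (fun t : ℝ => 2 * (π * t) * x) (2 * π * x) t := by
      have := ((hasDerivAt_id t).const_mul (2 * π)).mul_const x
      simp only [id] at this
      convert! this using 1
      · ext; ring
      · ring
    refine (h1.cos.neg.div_const (2 * π * x)).congr_deriv ?_
    field_simp
  rw [intervalIntegral.integral_eq_sub_of_hasDerivAt hd (Continuous.intervalIntegrable (by fun_prop) _ _)]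
  have e : cos (2 * (π * 1) * x) = 1 - 2 * sin (π * x) ^ 2 := by
    rw [show 2 * (π * 1) * x = 2 * (π * x) by ring, cos_two_mul, cos_sq']
    ring
  rw [e]
  simp
  field_simp
  ring

/-- The triangle function integrates to `1 / 2` against the Dirichlet kernel. -/
lemma integral_dirichlet (N : ℕ) :
    ∫ t in (0 : ℝ)..1, 2 * (1 - t) * (sin ((2 * N + 1) * (π * t)) / sin (π * t)) = 1 := by
  have h1 : ∫ t in (0 : ℝ)..1, 2 * (1 - t) * (sin ((2 * N + 1) * (π * t)) / sin (π * t)) =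
      ∫ t in (0 : ℝ)..1, (2 * (1 - t) * cos (2 * (π * t) * 0) +
        2 * ∑ n ∈ Finset.range N, 2 * (1 - t) * cos (2 * (π * t) * ((n : ℝ) + 1))) := by
    refine intervalIntegral_congr_Ioo fun t h0 h1 => ?_
    have hs := sin_pi_mul_pos h0 h1
    rw [← sum_cos_dirichlet, mul_div_cancel_left₀ _ hs.ne', ← Finset.mul_sum]
    simp
    ring
  rw [h1, intervalIntegral.integral_add (Continuous.intervalIntegrable (by fun_prop) _ _)
    (Continuous.intervalIntegrable (by fun_prop) _ _), intervalIntegral.integral_const_mul,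
    intervalIntegral.integral_finsetSum
      (fun n _ => Continuous.intervalIntegrable (by fun_prop) _ _)]
  change fejer 0 + 2 * ∑ n ∈ Finset.range N, fejer ((n : ℝ) + 1) = 1
  simp [fejer_natCast_add_one, fejer_zero]

/-- Summing the cosine transforms over integer shifts produces Dirichlet kernels. Their oscillating
parts vanish in the limit by Riemann–Lebesgue; what remains is 1 from the triangle function and a
cotangent integral, which is `beurling` up to the 1/π added to its weight. -/
lemma tendsto_sum_fejer {x : ℝ} (hx : x ≠ 0) :
    Tendsto (fun N : ℕ => fejer x + 2 * ∑ n ∈ Finset.range N, fejer (x + ((n : ℝ) + 1))) atTop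
      (nhds (1 - beurling x + 2 / π * (sin (π * x) ^ 2 / (π * x)))) := by
  have hπ := pi_pos
  have hg1 : IntervalIntegrable
      (fun t => (1 - t) * (2 * (cos (2 * (π * t) * x) - 1)) / sin (π * t)) volume 0 1 := by
    refine intervalIntegrable_of_bound (C := 4 * π * |x|) (by fun_prop) fun t h0 h1 =>
      abs_mul_div_sin_le h0 h1 ?_
    have : |cos (2 * (π * t) * x) - cos 0| ≤ |2 * (π * t) * x - 0| := abs_cos_sub_cos_le _ _
    rw [cos_zero, sub_zero, abs_mul _ x, abs_of_pos (by positivity : 0 < 2 * (π * t))] at this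
    rw [abs_mul, abs_two]
    linarith
  have hg2 : IntervalIntegrable
      (fun t => (1 - t) * (2 * sin (2 * (π * t) * x)) / sin (π * t)) volume 0 1 := by
    refine intervalIntegrable_of_bound (C := 4 * π * |x|) (by fun_prop) fun t h0 h1 =>
      abs_mul_div_sin_le h0 h1 ?_
    have : |sin (2 * (π * t) * x)| ≤ |2 * (π * t) * x| := abs_sin_le_abs
    rw [abs_mul _ x, abs_of_pos (by positivity : 0 < 2 * (π * t))] at this
    rw [abs_mul, abs_two]
    linarith
  have hD : ∀ N : ℕ, IntervalIntegrable
      (fun t => 2 * (1 - t) * (sin ((2 * N + 1) * (π * t)) / sin (π * t))) volume 0 1 := by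
    intro N
    refine intervalIntegrable_of_bound (C := 2 * (2 * N + 1) * π) (by fun_prop) fun t h0 h1 => ?_
    rw [show 2 * (1 - t) * (sin ((2 * N + 1) * (π * t)) / sin (π * t)) =
      (1 - t) * (2 * sin ((2 * N + 1) * (π * t))) / sin (π * t) by ring]
    refine abs_mul_div_sin_le h0 h1 ?_
    have : |sin ((2 * N + 1) * (π * t))| ≤ |(2 * N + 1) * (π * t)| := abs_sin_le_abs
    rw [abs_of_pos (by positivity : 0 < (2 * (N : ℝ) + 1) * (π * t))] at this
    rw [abs_mul, abs_two]
    linarith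
  have hS : IntervalIntegrable (fun t => 2 / π * sin (2 * (π * t) * x)) volume 0 1 :=
    Continuous.intervalIntegrable (by fun_prop) _ _
  -- Subtracting 1 from the cosine makes its quotient by sin(πt) bounded; the subtracted Dirichlet
  -- kernel integrates exactly to 1 by `integral_dirichlet`.
  have hN : ∀ N : ℕ, fejer x + 2 * ∑ n ∈ Finset.range N, fejer (x + ((n : ℝ) + 1)) =
      (∫ t in (0 : ℝ)..1, (1 - t) * (2 * (cos (2 * (π * t) * x) - 1)) / sin (π * t)
        * sin ((2 * N + 1) * (π * t)))
      + (∫ t in (0 : ℝ)..1, (1 - t) * (2 * sin (2 * (π * t) * x)) / sin (π * t)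
        * cos ((2 * N + 1) * (π * t)))
      + (1 - beurling x + 2 / π * (sin (π * x) ^ 2 / (π * x))) := by
    intro N
    have hi1 := hg1.mul_continuousOn (g := fun t => sin ((2 * N + 1) * (π * t)))
      (by fun_prop)
    have hi2 := hg2.mul_continuousOn (g := fun t => cos ((2 * N + 1) * (π * t)))
      (by fun_prop)
    have hB := intervalIntegrable_beurling x
    have e0 : 1 - beurling x + 2 / π * (sin (π * x) ^ 2 / (π * x)) = ∫ t in (0 : ℝ)..1,
        (2 * (1 - t) * (sin ((2 * N + 1) * (π * t)) / sin (π * t))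
          - 2 * beurlingWeight t * sin (2 * (π * t) * x) + 2 / π * sin (2 * (π * t) * x)) := by
      rw [intervalIntegral.integral_add ((hD N).sub hB) hS,
        intervalIntegral.integral_sub (hD N) hB, integral_dirichlet N,
        intervalIntegral.integral_const_mul, integral_sin_two_pi hx, beurling]
    rw [e0, ← intervalIntegral.integral_add hi1 hi2,
      ← intervalIntegral.integral_add (hi1.add hi2) (((hD N).sub hB).add hS)]
    unfold fejer
    rw [← intervalIntegral.integral_finsetSum
      (fun n _ => Continuous.intervalIntegrable (by fun_prop) _ _),
      ← intervalIntegral.integral_const_mul,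
      ← intervalIntegral.integral_add (Continuous.intervalIntegrable (by fun_prop) _ _)
        (Continuous.intervalIntegrable (by fun_prop) _ _)]
    refine intervalIntegral_congr_Ioo fun t h0 h1 => ?_
    have hs := (sin_pi_mul_pos h0 h1).ne'
    have e1 := sum_cos_dirichlet N (π * t)
    have e2 := sum_sin_dirichlet N (π * t)
    have e3 : ∑ n ∈ Finset.range N, 2 * (1 - t) * cos (2 * (π * t) * (x + ((n : ℝ) + 1))) =
        2 * (1 - t) * (cos (2 * (π * t) * x) * ∑ n ∈ Finset.range N, cos (2 * (π * t) * (n + 1))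
          - sin (2 * (π * t) * x) * ∑ n ∈ Finset.range N, sin (2 * (π * t) * (n + 1))) := by
      rw [Finset.mul_sum, Finset.mul_sum, ← Finset.sum_sub_distrib, Finset.mul_sum]
      refine Finset.sum_congr rfl fun n _ => ?_
      rw [mul_add, cos_add]
    rw [e3]
    unfold beurlingWeight
    rw [← e1]
    rw [show cos ((2 * N + 1) * (π * t)) = cos (π * t) - sin (π * t) *
      (2 * ∑ n ∈ Finset.range N, sin (2 * (π * t) * (n + 1))) by linarith]
    generalize ∑ n ∈ Finset.range N, sin (2 * (π * t) * ((n : ℝ) + 1)) = S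
    generalize ∑ n ∈ Finset.range N, cos (2 * (π * t) * ((n : ℝ) + 1)) = C
    generalize sin (π * t) = s at hs
    field_simp
    ring
  have hlim := ((tendsto_integral_mul_cos_sin hg1).2.add (tendsto_integral_mul_cos_sin hg2).1).add_const
    (1 - beurling x + 2 / π * (sin (π * x) ^ 2 / (π * x)))
  rw [zero_add, zero_add] at hlim
  exact hlim.congr fun N => (hN N).symm

lemma sin_pi_mul_add_natCast_sq (x : ℝ) (n : ℕ) : sin (π * (x + n)) ^ 2 = sin (π * x) ^ 2 := by
  rw [mul_add, mul_comm π (n : ℝ), sin_add_nat_mul_pi, mul_pow, ← pow_mul, mul_comm n 2, pow_mul]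
  simp

lemma fejer_add {x : ℝ} (hx : 0 < x) (n : ℕ) :
    fejer (x + n) = sin (π * x) ^ 2 / π ^ 2 * (1 / (x + n) ^ 2) := by
  rw [fejer_eq (by positivity), sin_pi_mul_add_natCast_sq, mul_pow]
  field_simp

lemma sum_inv_sq_le {x : ℝ} (hx : 0 < x) (N : ℕ) :
    ∑ n ∈ Finset.range N, 1 / (x + ((n + 1 : ℕ) : ℝ)) ^ 2 ≤ 1 / x := by
  suffices h : ∑ n ∈ Finset.range N, 1 / (x + ((n + 1 : ℕ) : ℝ)) ^ 2 ≤ 1 / x - 1 / (x + N) from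
    h.trans (sub_le_self _ (by positivity))
  induction N with
  | zero => simp
  | succ N ih =>
    rw [Finset.sum_range_succ]
    have : 1 / (x + ((N + 1 : ℕ) : ℝ)) ^ 2 ≤ 1 / (x + N) - 1 / (x + ((N + 1 : ℕ) : ℝ)) := by
      have h1 : 0 < x + N := by positivity
      push_cast
      rw [div_sub_div _ _ (by positivity) (by positivity), div_le_div_iff₀ (by positivity) (by positivity)]
      nlinarith
    linarith

lemma le_sum_inv_sq {x : ℝ} (hx : 0 < x) (N : ℕ) :
    1 / x - 1 / (x + N) ≤ ∑ n ∈ Finset.range N, 1 / (x + (n : ℝ)) ^ 2 := by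
  induction N with
  | zero => simp
  | succ N ih =>
    rw [Finset.sum_range_succ]
    have : 1 / (x + N) - 1 / (x + ((N + 1 : ℕ) : ℝ)) ≤ 1 / (x + (N : ℝ)) ^ 2 := by
      have h1 : 0 < x + N := by positivity
      push_cast
      rw [div_sub_div _ _ (by positivity) (by positivity), div_le_div_iff₀ (by positivity) (by positivity)]
      nlinarith
    linarith

/-- Beurling's function approximates the sign function within the Fejér kernel. -/
lemma abs_one_sub_beurling_le {x : ℝ} (hx : 0 < x) : |1 - beurling x| ≤ fejer x := by
  have hπ := pi_pos
  have hlim := tendsto_sum_fejer hx.ne'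
  set s := sin (π * x) ^ 2 / π ^ 2 with hs
  have hs0 : 0 ≤ s := by positivity
  have e0 : fejer x = s * (1 / x ^ 2) := by simpa using fejer_add hx 0
  have e1 : 2 / π * (sin (π * x) ^ 2 / (π * x)) = 2 * s * (1 / x) := by
    rw [hs]; field_simp
  have e2 : ∀ N : ℕ, ∑ n ∈ Finset.range N, fejer (x + ((n : ℝ) + 1)) =
      s * ∑ n ∈ Finset.range N, 1 / (x + ((n + 1 : ℕ) : ℝ)) ^ 2 := by
    intro N
    rw [Finset.mul_sum]
    refine Finset.sum_congr rfl fun n _ => ?_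
    rw [← fejer_add hx]
    push_cast
    rfl
  rw [e1] at hlim
  -- Both bounds come from Σ_{n≥1} (x+n)⁻² ≤ 1/x ≤ Σ_{n≥0} (x+n)⁻². The term n = 0 of the second sum
  -- is the Fejér kernel at x, up to the factor s.
  have hup : 1 - beurling x + 2 * s * (1 / x) ≤ fejer x + 2 * (s * (1 / x)) := by
    refine le_of_tendsto' hlim fun N => ?_
    rw [e2]
    have := mul_le_mul_of_nonneg_left (sum_inv_sq_le hx N) hs0
    linarith
  have hlow : -fejer x + 2 * (s * (1 / x)) ≤ 1 - beurling x + 2 * s * (1 / x) := by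
    have hl2 : Tendsto (fun N : ℕ => -fejer x + 2 * (s * (1 / x - 1 / (x + ((N + 1 : ℕ) : ℝ))))) atTop
        (nhds (-fejer x + 2 * (s * (1 / x - 0)))) := by
      have h0 : Tendsto (fun N : ℕ => 1 / (x + ((N + 1 : ℕ) : ℝ))) atTop (nhds 0) := by
        simp only [one_div]
        refine tendsto_inv_atTop_zero.comp (tendsto_atTop_add_const_left _ _ ?_)
        exact tendsto_natCast_atTop_atTop.comp (tendsto_add_atTop_nat 1)
      exact (((h0.const_sub _).const_mul _).const_mul _).const_add _
    rw [sub_zero] at hl2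
    refine le_of_tendsto_of_tendsto' hl2 hlim fun N => ?_
    rw [e2]
    have h3 := mul_le_mul_of_nonneg_left (le_sum_inv_sq hx (N + 1)) hs0
    rw [Finset.sum_range_succ', mul_add] at h3
    simp only [Nat.cast_zero, add_zero] at h3
    rw [← e0] at h3
    linarith
  rw [abs_le]
  constructor <;> linarith

end BeurlingSelberg

end ColorUrn

namespace ColorUrn

/-! ### Selberg majorants and the smoothing inequality. -/

section Smoothing

open Real

@[fun_prop]
lemma continuous_fejer : Continuous fejer := by
  unfold fejer
  apply intervalIntegral.continuous_parametric_intervalIntegral_of_continuous'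
  fun_prop

@[fun_prop]
lemma measurable_beurling : Measurable beurling := by
  have h : StronglyMeasurable (Function.uncurry fun (x t : ℝ) =>
      2 * beurlingWeight t * sin (2 * (π * t) * x)) := by
    apply Measurable.stronglyMeasurable
    unfold Function.uncurry
    fun_prop
  have := h.integral_prod_right (ν := volume.restrict (Set.Ioc (0 : ℝ) 1))
  convert this.measurable using 1
  ext x
  rw [beurling, intervalIntegral.integral_of_le zero_le_one]

lemma fejer_le_one (x : ℝ) : fejer x ≤ 1 := by
  rw [← fejer_zero]
  unfold fejer
  refine intervalIntegral.integral_mono_on zero_le_one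
    (Continuous.intervalIntegrable (by fun_prop) _ _)
    (Continuous.intervalIntegrable (by fun_prop) _ _) fun t ht => ?_
  rw [mul_zero, cos_zero]
  exact mul_le_mul_of_nonneg_left (cos_le_one _) (by linarith [ht.2])

lemma abs_sign_sub_beurling_le (x : ℝ) : |Real.sign x - beurling x| ≤ fejer x := by
  rcases lt_trichotomy x 0 with h | rfl | h
  · have := abs_one_sub_beurling_le (neg_pos.2 h)
    rw [beurling_neg, fejer_neg] at this
    rw [Real.sign_of_neg h, ← abs_neg]
    convert this using 2
    ring
  · simp [beurling_zero, fejer_zero]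
  · rw [Real.sign_of_pos h]
    exact abs_one_sub_beurling_le h

/-- Integrating the cosine over [-(N+1/2), N+1/2] gives sin((2N+1)πt)/(πt). Replacing πt by sin(πt)
in the denominator costs a bounded factor times an oscillation, and the Dirichlet integral is 1. -/
lemma tendsto_integral_fejer :
    Tendsto (fun N : ℕ => ∫ x in (-((N : ℝ) + 1 / 2))..((N : ℝ) + 1 / 2), fejer x) atTop
      (nhds 1) := by
  have hπ := pi_pos
  have hg : IntervalIntegrable
      (fun t => 2 * ((1 - t) * (1 / (π * t) - 1 / sin (π * t)))) volume 0 1 := by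
    refine intervalIntegrable_of_bound (C := 2 * π) (by fun_prop) fun t h0 h1 => ?_
    have hs := sin_pi_mul_pos h0 h1
    have e : (1 - t) * (1 / (π * t) - 1 / sin (π * t)) =
        (1 - t) * (sin (π * t) / (π * t) - 1) / sin (π * t) := by
      rw [mul_div_assoc, sub_div]
      congr 2
      rw [div_right_comm, div_self hs.ne']
    rw [abs_mul, abs_two, e]
    refine mul_le_mul_of_nonneg_left (abs_mul_div_sin_le h0 h1 ?_) zero_le_two
    have h2 : sin (π * t) / (π * t) ≤ 1 := by
      rw [div_le_one (by positivity)]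
      exact sin_le (by positivity)
    have h3 : cos (π * t) ≤ sin (π * t) / (π * t) := by
      rw [le_div_iff₀ (by positivity), mul_comm]
      exact mul_cos_le_sin (by positivity) (by nlinarith)
    have h4 : |cos (π * t) - cos 0| ≤ |π * t - 0| := abs_cos_sub_cos_le _ _
    rw [cos_zero, sub_zero, abs_of_pos (by positivity : 0 < π * t)] at h4
    rw [abs_le] at h4 ⊢
    constructor <;> linarith [mul_pos hπ h0]
  have hN : ∀ N : ℕ, ∫ x in (-((N : ℝ) + 1 / 2))..((N : ℝ) + 1 / 2), fejer x =
      (∫ t in (0 : ℝ)..1, 2 * ((1 - t) * (1 / (π * t) - 1 / sin (π * t)))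
        * sin ((2 * N + 1) * (π * t))) + 1 := by
    intro N
    have hD : IntervalIntegrable
        (fun t => 2 * (1 - t) * (sin ((2 * N + 1) * (π * t)) / sin (π * t))) volume 0 1 := by
      refine intervalIntegrable_of_bound (C := 2 * (2 * N + 1) * π) (by fun_prop) fun t h0 h1 => ?_
      rw [show 2 * (1 - t) * (sin ((2 * N + 1) * (π * t)) / sin (π * t)) =
        (1 - t) * (2 * sin ((2 * N + 1) * (π * t))) / sin (π * t) by ring]
      refine abs_mul_div_sin_le h0 h1 ?_
      have : |sin ((2 * N + 1) * (π * t))| ≤ |(2 * N + 1) * (π * t)| := abs_sin_le_abs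
      rw [abs_of_pos (by positivity : 0 < (2 * (N : ℝ) + 1) * (π * t))] at this
      rw [abs_mul, abs_two]
      linarith
    have hi := hg.mul_continuousOn (g := fun t => sin ((2 * N + 1) * (π * t))) (by fun_prop)
    have hswap : ∫ x in (-((N : ℝ) + 1 / 2))..((N : ℝ) + 1 / 2), fejer x =
        ∫ t in (0 : ℝ)..1, ∫ x in (-((N : ℝ) + 1 / 2))..((N : ℝ) + 1 / 2),
          2 * (1 - t) * cos (2 * (π * t) * x) := by
      unfold fejer
      refine intervalIntegral_intervalIntegral_swap ?_
      refine (Continuous.continuousOn (by unfold Function.uncurry; fun_prop)).integrableOn_compact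
        (isCompact_uIcc.prod isCompact_uIcc) |>.mono_set
        (Set.prod_mono Set.uIoc_subset_uIcc Set.uIoc_subset_uIcc)
    have e0 : ∀ c : ℝ, c + 1 = c + ∫ t in (0 : ℝ)..1,
      2 * (1 - t) * (sin ((2 * N + 1) * (π * t)) / sin (π * t)) := fun c => by
        rw [integral_dirichlet N]
    rw [hswap, e0, ← intervalIntegral.integral_add hi hD]
    refine intervalIntegral_congr_Ioo fun t h0 h1 => ?_
    have hs := (sin_pi_mul_pos h0 h1).ne'
    have hpt : 2 * (π * t) ≠ 0 := by positivity
    rw [intervalIntegral.integral_const_mul, intervalIntegral.integral_comp_mul_left _ hpt,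
      integral_cos]
    have e1 : 2 * (π * t) * ((N : ℝ) + 1 / 2) = (2 * N + 1) * (π * t) := by ring
    rw [mul_neg, e1, sin_neg, smul_eq_mul]
    generalize sin ((2 * (N : ℝ) + 1) * (π * t)) = S
    generalize sin (π * t) = s at hs
    field_simp
    ring
  have hlim := (tendsto_integral_mul_cos_sin hg).2.add_const 1
  rw [zero_add] at hlim
  exact hlim.congr fun N => (hN N).symm

lemma integrable_fejer : Integrable fejer := by
  have h1 : Tendsto (fun N : ℕ => (N : ℝ) + 1 / 2) atTop atTop :=
    tendsto_atTop_add_const_right _ _ tendsto_natCast_atTop_atTop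
  refine integrable_of_intervalIntegral_norm_tendsto 1 (fun N : ℕ => ?_)
    (tendsto_neg_atTop_atBot.comp h1) h1 ?_
  · exact (continuous_fejer.integrableOn_Icc).mono_set Set.Ioc_subset_Icc_self
  · refine tendsto_integral_fejer.congr fun N => ?_
    simp [abs_of_nonneg (fejer_nonneg _)]

lemma integral_fejer : ∫ x, fejer x = 1 := by
  have h1 : Tendsto (fun N : ℕ => (N : ℝ) + 1 / 2) atTop atTop :=
    tendsto_atTop_add_const_right _ _ tendsto_natCast_atTop_atTop
  exact tendsto_nhds_unique (intervalIntegral_tendsto_integral integrable_fejer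
    (tendsto_neg_atTop_atBot.comp h1) h1) tendsto_integral_fejer

@[fun_prop]
lemma measurable_sign : Measurable Real.sign := by
  unfold Real.sign
  exact Measurable.ite measurableSet_Iio measurable_const
    (Measurable.ite measurableSet_Ioi measurable_const measurable_const)

/-- The Beurling–Selberg majorant (`ε = 1`) and minorant (`ε = -1`) of the Heaviside function. -/
noncomputable def selberg (ε x : ℝ) : ℝ := (1 + beurling x + ε * fejer x) / 2

@[fun_prop]
lemma measurable_selberg (ε : ℝ) : Measurable (selberg ε) := by
  unfold selberg
  fun_prop

lemma abs_selberg_le {ε : ℝ} (hε : |ε| = 1) (x : ℝ) : |selberg ε x| ≤ 2 := by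
  have h1 := abs_sign_sub_beurling_le x
  have h2 := fejer_le_one x
  have h3 : |ε * fejer x| ≤ 1 := by
    rw [abs_mul, hε, one_mul, abs_of_nonneg (fejer_nonneg x)]
    exact h2
  have h4 : |Real.sign x| ≤ 1 := by
    rcases Real.sign_apply_eq x with h | h | h <;> simp [h]
  unfold selberg
  rw [abs_le] at *
  constructor <;> linarith

/-- The Heaviside function. -/
noncomputable def heaviside (x : ℝ) : ℝ := Set.indicator (Set.Ici 0) 1 x

lemma heaviside_eq {x : ℝ} (hx : x ≠ 0) : heaviside x = (1 + Real.sign x) / 2 := by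
  rcases hx.lt_or_gt with h | h
  · simp [heaviside, Real.sign_of_neg h, h]
  · simp [heaviside, Real.sign_of_pos h, h.le]

lemma selberg_sub_heaviside_nonneg {ε : ℝ} (hε : ε = 1 ∨ ε = -1) (x : ℝ) :
    0 ≤ ε * (selberg ε x - heaviside x) := by
  rcases eq_or_ne x 0 with rfl | hx
  · rcases hε with rfl | rfl <;> simp [selberg, heaviside, beurling_zero, fejer_zero]
  · have h1 := abs_le.1 (abs_sign_sub_beurling_le x)
    rw [heaviside_eq hx, selberg]
    rcases hε with rfl | rfl <;> linarith [h1.1, h1.2]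

/-- The part sign - `beurling` is odd and integrates to 0, so only half the mass of the Fejér kernel
remains. -/
lemma integral_selberg_sub_heaviside {ε : ℝ} (hε : ε = 1 ∨ ε = -1) :
    Integrable (fun x => ε * (selberg ε x - heaviside x)) ∧
      ∫ x, ε * (selberg ε x - heaviside x) = 1 / 2 := by
  have hi : Integrable (fun x => Real.sign x - beurling x) :=
    integrable_fejer.mono' (measurable_sign.sub measurable_beurling).aestronglyMeasurable
      (.of_forall abs_sign_sub_beurling_le)
  have hodd : ∫ x, (Real.sign x - beurling x) = 0 := by
    have := integral_neg_eq_self (fun x => Real.sign x - beurling x) volume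
    simp only [Real.sign_neg, beurling_neg] at this
    have h2 : ∫ x, (-Real.sign x - -beurling x) = -∫ x, (Real.sign x - beurling x) := by
      rw [← integral_neg]
      congr 1
      ext x
      ring
    linarith
  have hae : (fun x => ε * (selberg ε x - heaviside x)) =ᵐ[volume]
      fun x => (-ε / 2) * (Real.sign x - beurling x) + 1 / 2 * fejer x := by
    have : ∀ᵐ x : ℝ, x ≠ 0 := by simp [ae_iff]
    filter_upwards [this] with x hx
    rw [heaviside_eq hx, selberg]
    rcases hε with rfl | rfl <;> ring
  refine ⟨((hi.const_mul _).add (integrable_fejer.const_mul _)).congr hae.symm, ?_⟩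
  rw [integral_congr_ae hae, integral_add (hi.const_mul _) (integrable_fejer.const_mul _),
    integral_const_mul, integral_const_mul, hodd, integral_fejer]
  ring

variable {μ ν : Measure ℝ} [IsProbabilityMeasure μ] [IsProbabilityMeasure ν]

lemma integral_selberg_comp (hμ : Integrable (fun y => y) μ) (ε τ x : ℝ) :
    IntervalIntegrable (fun t => beurlingWeight t * (∫ y, sin (2 * (π * t) * (τ * (x - y))) ∂μ)
        + ε * (1 - t) * ∫ y, cos (2 * (π * t) * (τ * (x - y))) ∂μ) volume 0 1 ∧
    ∫ y, selberg ε (τ * (x - y)) ∂μ = 1 / 2 + ∫ t in (0 : ℝ)..1,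
      (beurlingWeight t * (∫ y, sin (2 * (π * t) * (τ * (x - y))) ∂μ)
        + ε * (1 - t) * ∫ y, cos (2 * (π * t) * (τ * (x - y))) ∂μ) := by
  -- The finite first moment enters here: the sine term is dominated only by a multiple of |τ(x -
  -- y)|, and Fubini needs this to be integrable.
  have hint : Integrable (fun y => 2 * |τ * (x - y)| + |ε|) μ := by
    have := (((integrable_const x).sub hμ).const_mul τ).abs.const_mul 2
    exact this.add (integrable_const _)
  have hb : ∀ y, ∀ t : ℝ, 0 < t → t < 1 →
      |beurlingWeight t * sin (2 * (π * t) * (τ * (x - y)))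
        + ε * (1 - t) * cos (2 * (π * t) * (τ * (x - y)))| ≤ 2 * |τ * (x - y)| + |ε| := by
    intro y t h0 h1
    have h2 := abs_beurlingWeight_mul_sin_le h0 h1 (τ * (x - y))
    rw [mul_assoc, abs_mul, abs_two] at h2
    have h3 : |ε * (1 - t) * cos (2 * (π * t) * (τ * (x - y)))| ≤ |ε| := by
      rw [abs_mul, abs_mul, abs_of_pos (by linarith : 0 < 1 - t), mul_assoc]
      refine mul_le_of_le_one_right (abs_nonneg _) (mul_le_one₀ (by linarith) (abs_nonneg _) (abs_cos_le_one _))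
    refine (abs_add_le _ _).trans (by linarith)
  have hprod : Integrable (Function.uncurry fun (y t : ℝ) =>
      beurlingWeight t * sin (2 * (π * t) * (τ * (x - y)))
        + ε * (1 - t) * cos (2 * (π * t) * (τ * (x - y))))
      (μ.prod (volume.restrict (Set.Ioo (0 : ℝ) 1))) := by
    have hm : Measurable (Function.uncurry fun (y t : ℝ) =>
      beurlingWeight t * sin (2 * (π * t) * (τ * (x - y)))
        + ε * (1 - t) * cos (2 * (π * t) * (τ * (x - y)))) := by
      unfold Function.uncurry
      fun_prop
    have hdom : Integrable (fun z : ℝ × ℝ => 2 * |τ * (x - z.1)| + |ε|)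
        (μ.prod (volume.restrict (Set.Ioo (0 : ℝ) 1))) := hint.comp_fst _
    refine hdom.mono' hm.aestronglyMeasurable ?_
    have : ∀ᵐ z ∂(μ.prod (volume.restrict (Set.Ioo (0 : ℝ) 1))), z.2 ∈ Set.Ioo (0 : ℝ) 1 :=
      Measure.quasiMeasurePreserving_snd.ae (ae_restrict_mem measurableSet_Ioo)
    filter_upwards [this] with z hz
    exact hb z.1 z.2 hz.1 hz.2
  have hinner : ∀ t : ℝ, ∫ y, (beurlingWeight t * sin (2 * (π * t) * (τ * (x - y)))
        + ε * (1 - t) * cos (2 * (π * t) * (τ * (x - y)))) ∂μ =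
      beurlingWeight t * (∫ y, sin (2 * (π * t) * (τ * (x - y))) ∂μ)
        + ε * (1 - t) * ∫ y, cos (2 * (π * t) * (τ * (x - y))) ∂μ := by
    intro t
    have hs : Integrable (fun y => sin (2 * (π * t) * (τ * (x - y)))) μ :=
      .of_bound (by fun_prop) 1 (.of_forall fun y => abs_sin_le_one _)
    have hc : Integrable (fun y => cos (2 * (π * t) * (τ * (x - y)))) μ :=
      .of_bound (by fun_prop) 1 (.of_forall fun y => abs_cos_le_one _)
    rw [integral_add (hs.const_mul _) (hc.const_mul _), integral_const_mul, integral_const_mul]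
  refine ⟨?_, ?_⟩
  · rw [intervalIntegrable_iff_integrableOn_Ioo_of_le zero_le_one]
    have hright := hprod.integral_prod_right
    simp only [Function.uncurry_apply_pair, hinner] at hright
    exact hright
  have hpt : ∀ z, selberg ε z = 1 / 2 + ∫ t in Set.Ioo (0 : ℝ) 1,
      (beurlingWeight t * sin (2 * (π * t) * z) + ε * (1 - t) * cos (2 * (π * t) * z)) := by
    intro z
    rw [← integral_Ioc_eq_integral_Ioo, ← intervalIntegral.integral_of_le zero_le_one, selberg,
      beurling, fejer, ← intervalIntegral.integral_const_mul, add_assoc,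
      ← intervalIntegral.integral_add (intervalIntegrable_beurling z)
        (Continuous.intervalIntegrable (by fun_prop) _ _), add_div,
      ← intervalIntegral.integral_div]
    congr 2
    ext t
    ring
  simp_rw [hpt]
  have hleft := hprod.integral_prod_left
  simp only [Function.uncurry_apply_pair] at hleft
  rw [integral_add (integrable_const _) hleft]
  simp only [integral_const, probReal_univ, smul_eq_mul, one_mul]
  congr 1
  have hsw := integral_integral_swap hprod
  rw [intervalIntegral.integral_of_le zero_le_one, integral_Ioc_eq_integral_Ioo]
  refine hsw.trans (setIntegral_congr_fun measurableSet_Ioo fun t _ => hinner t)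

lemma charFun_neg_mul_exp (u x : ℝ) :
    Complex.exp (u * x * Complex.I) * charFun μ (-u) =
      ((∫ y, cos (u * (x - y)) ∂μ : ℝ) : ℂ) + ((∫ y, sin (u * (x - y)) ∂μ : ℝ) : ℂ) * Complex.I := by
  have hs : Integrable (fun y => sin (u * (x - y))) μ :=
    .of_bound (by fun_prop) 1 (.of_forall fun y => abs_sin_le_one _)
  have hc : Integrable (fun y => cos (u * (x - y))) μ :=
    .of_bound (by fun_prop) 1 (.of_forall fun y => abs_cos_le_one _)
  rw [charFun_apply_real, ← integral_const_mul, ← integral_complex_ofReal,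
    ← integral_complex_ofReal, ← integral_mul_const,
    ← integral_add hc.ofReal (hs.ofReal.mul_const _)]
  congr 1
  ext y
  rw [← Complex.exp_add, Complex.ofReal_cos, Complex.ofReal_sin, ← Complex.exp_mul_I]
  congr 1
  push_cast
  ring

/-- The two differences are the real and imaginary parts of a difference of characteristic functions
at -u, rotated by exp(iux); neither rotation nor conjugation changes the modulus. -/
lemma sq_add_sq_trig_integral_sub (u x : ℝ) :
    ((∫ y, cos (u * (x - y)) ∂μ) - ∫ y, cos (u * (x - y)) ∂ν) ^ 2
      + ((∫ y, sin (u * (x - y)) ∂μ) - ∫ y, sin (u * (x - y)) ∂ν) ^ 2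
      = ‖charFun μ u - charFun ν u‖ ^ 2 := by
  have h1 := charFun_neg_mul_exp (μ := μ) u x
  have h2 := charFun_neg_mul_exp (μ := ν) u x
  have h3 : ‖charFun μ u - charFun ν u‖ =
      ‖Complex.exp (u * x * Complex.I) * charFun μ (-u)
        - Complex.exp (u * x * Complex.I) * charFun ν (-u)‖ := by
    rw [← mul_sub, norm_mul, charFun_neg, charFun_neg, ← map_sub, RCLike.norm_conj]
    rw [show (u : ℂ) * x * Complex.I = ((u * x : ℝ) : ℂ) * Complex.I by push_cast; ring,
      Complex.norm_exp_ofReal_mul_I, one_mul]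
  rw [h3, h1, h2, ← Complex.normSq_eq_norm_sq, add_sub_add_comm, ← sub_mul, ← Complex.ofReal_sub,
    ← Complex.ofReal_sub, Complex.normSq_add_mul_I]

/-- Since (1 - t)πt ≤ π/4 < 0.7855, the constant only has to exceed √(1 + 0.7855²) ≈ 1.272. -/
lemma sqrt_beurlingWeight_le {t : ℝ} (h0 : 0 < t) (h1 : t < 1) :
    √(beurlingWeight t ^ 2 + (1 - t) ^ 2) ≤ 1.28 / (π * t) := by
  have hπ := pi_pos
  have hw := beurlingWeight_nonneg h0 h1
  have hw2 := beurlingWeight_le h0 h1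
  have hp : 0 < π * t := by positivity
  refine sqrt_le_iff.2 ⟨by positivity, ?_⟩
  rw [le_div_iff₀ hp] at hw2
  have h3 : (1 - t) * (π * t) ≤ 0.7855 := by
    have : π < 3.1416 := pi_lt_d4
    nlinarith [sq_nonneg (t - 1 / 2), mul_pos h0 (sub_pos.2 h1)]
  have h4 : 0 ≤ (1 - t) * (π * t) := mul_nonneg (by linarith) hp.le
  rw [div_pow, le_div_iff₀ (by positivity), add_mul, ← mul_pow, ← mul_pow]
  have h5 := pow_le_pow_left₀ (by positivity) hw2 2
  have h6 := pow_le_pow_left₀ h4 h3 2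
  rw [one_pow] at h5
  norm_num at h6 ⊢
  linarith

lemma abs_add_le_sqrt_mul_sqrt (a b c d : ℝ) :
    |a * b + c * d| ≤ √(a ^ 2 + c ^ 2) * √(d ^ 2 + b ^ 2) := by
  rw [← sqrt_mul (by positivity)]
  refine abs_le_sqrt ?_
  nlinarith [sq_nonneg (a * d - c * b)]

/-- **Smoothing inequality** for the Kolmogorov distance, with the extremal constant: `μ` is compared
with a measure `ν` of density at most `m`. -/
theorem abs_measureReal_Iic_sub_le (hμ : Integrable (fun y => y) μ) (hν : Integrable (fun y => y) ν)
    {m : ℝ} (hm : 0 ≤ m) (hνm : ν ≤ ENNReal.ofReal m • volume) {τ : ℝ} (hτ : 0 < τ) {G : ℝ → ℝ}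
    (hG : IntervalIntegrable G volume 0 1)
    (hle : ∀ t, 0 < t → t < 1 →
      ‖charFun μ (2 * π * τ * t) - charFun ν (2 * π * τ * t)‖ ≤ t * G t) (x : ℝ) :
    |μ.real (Set.Iic x) - ν.real (Set.Iic x)| ≤
      1.28 / π * (∫ t in (0 : ℝ)..1, G t) + m / (2 * τ) := by
  have hπ := pi_pos
  have hheav : ∀ (ρ : Measure ℝ) [IsProbabilityMeasure ρ],
      Integrable (fun y => heaviside (τ * (x - y))) ρ ∧
      ∫ y, heaviside (τ * (x - y)) ∂ρ = ρ.real (Set.Iic x) := by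
    intro ρ _
    have e : (fun y => heaviside (τ * (x - y))) = (Set.Iic x).indicator 1 := by
      ext y
      by_cases hy : y ≤ x
      · have : 0 ≤ τ * (x - y) := mul_nonneg hτ.le (by linarith)
        simp [heaviside, hy, this]
      · have : ¬ 0 ≤ τ * (x - y) := by
          push Not at hy
          nlinarith
        simp only [heaviside]
        rw [Set.indicator_of_notMem (by simpa using this), Set.indicator_of_notMem (by simpa using hy)]
    rw [e]
    exact ⟨(integrable_const (1 : ℝ)).indicator measurableSet_Iic, integral_indicator_one measurableSet_Iic⟩
  have hsel : ∀ (ε : ℝ), (ε = 1 ∨ ε = -1) → ∀ (ρ : Measure ℝ) [IsProbabilityMeasure ρ],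
      Integrable (fun y => selberg ε (τ * (x - y))) ρ := by
    intro ε hε ρ _
    refine .of_bound (Measurable.aestronglyMeasurable ((measurable_selberg ε).comp (by fun_prop))) 2
      (.of_forall fun y => abs_selberg_le ?_ _)
    rcases hε with rfl | rfl <;> simp
  have hdiff : ∀ ε : ℝ, (ε = 1 ∨ ε = -1) →
      ε * ((∫ y, selberg ε (τ * (x - y)) ∂μ) - ∫ y, selberg ε (τ * (x - y)) ∂ν)
        ≤ 1.28 / π * ∫ t in (0 : ℝ)..1, G t := by
    intro ε hε
    have hε2 : ε ^ 2 = 1 := by rcases hε with rfl | rfl <;> norm_num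
    obtain ⟨hiμ, heμ⟩ := integral_selberg_comp hμ ε τ x
    obtain ⟨hiν, heν⟩ := integral_selberg_comp hν ε τ x
    rw [heμ, heν, add_sub_add_left_eq_sub, ← intervalIntegral.integral_sub hiμ hiν,
      ← intervalIntegral.integral_const_mul, ← intervalIntegral.integral_const_mul,
      intervalIntegral.integral_of_le zero_le_one, intervalIntegral.integral_of_le zero_le_one,
      integral_Ioc_eq_integral_Ioo, integral_Ioc_eq_integral_Ioo]
    refine setIntegral_mono_on
      ((intervalIntegrable_iff_integrableOn_Ioo_of_le zero_le_one).1 ((hiμ.sub hiν).const_mul ε))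
      ((intervalIntegrable_iff_integrableOn_Ioo_of_le zero_le_one).1 (hG.const_mul _))
      measurableSet_Ioo fun t ht => ?_
    obtain ⟨h0, h1⟩ := ht
    have hu : ∀ y, 2 * (π * t) * (τ * (x - y)) = (2 * π * τ * t) * (x - y) := fun y => by ring
    simp_rw [hu]
    have hsq := sq_add_sq_trig_integral_sub (μ := μ) (ν := ν) (2 * π * τ * t) x
    set a := (∫ y, sin (2 * π * τ * t * (x - y)) ∂μ)
    set b := (∫ y, sin (2 * π * τ * t * (x - y)) ∂ν)
    set c := (∫ y, cos (2 * π * τ * t * (x - y)) ∂μ)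
    set d := (∫ y, cos (2 * π * τ * t * (x - y)) ∂ν)
    -- Cauchy–Schwarz treats sine and cosine parts together, so the modulus of the characteristic
    -- function difference appears just once.
    calc ε * (beurlingWeight t * a + ε * (1 - t) * c - (beurlingWeight t * b + ε * (1 - t) * d))
        = beurlingWeight t * (ε * (a - b)) + (1 - t) * (ε ^ 2 * (c - d)) := by ring
      _ ≤ √(beurlingWeight t ^ 2 + (1 - t) ^ 2) *
          √((ε ^ 2 * (c - d)) ^ 2 + (ε * (a - b)) ^ 2) :=
          (le_abs_self _).trans (abs_add_le_sqrt_mul_sqrt _ _ _ _)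
      _ = √(beurlingWeight t ^ 2 + (1 - t) ^ 2) *
          ‖charFun μ (2 * π * τ * t) - charFun ν (2 * π * τ * t)‖ := by
          rw [hε2, one_mul, mul_pow ε, hε2, one_mul, hsq, sqrt_sq (norm_nonneg _)]
      _ ≤ 1.28 / (π * t) * (t * G t) :=
          mul_le_mul (sqrt_beurlingWeight_le h0 h1) (hle t h0 h1) (norm_nonneg _) (by positivity)
      _ = 1.28 / π * G t := by field_simp
  have hgauss : ∀ ε : ℝ, (ε = 1 ∨ ε = -1) →
      ∫ y, ε * (selberg ε (τ * (x - y)) - heaviside (τ * (x - y))) ∂ν ≤ m / (2 * τ) := by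
    intro ε hε
    obtain ⟨hi, hval⟩ := integral_selberg_sub_heaviside hε
    have hi2 : Integrable (fun y => ε * (selberg ε (τ * (x - y)) - heaviside (τ * (x - y)))) :=
      (hi.comp_mul_left' hτ.ne').comp_sub_left x
    have h1 : ∫ y, ε * (selberg ε (τ * (x - y)) - heaviside (τ * (x - y))) ∂ν ≤
        ∫ y, ε * (selberg ε (τ * (x - y)) - heaviside (τ * (x - y))) ∂(ENNReal.ofReal m • volume) :=
      integral_mono_measure hνm (.of_forall fun y => selberg_sub_heaviside_nonneg hε _)
        (hi2.smul_measure ENNReal.ofReal_ne_top)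
    refine h1.trans (le_of_eq ?_)
    rw [integral_smul_measure, ENNReal.toReal_ofReal hm,
      integral_sub_left_eq_self (fun y => ε * (selberg ε (τ * y) - heaviside (τ * y))) volume x,
      Measure.integral_comp_mul_left (fun y => ε * (selberg ε y - heaviside y)) τ, hval,
      abs_of_pos (by positivity)]
    simp only [smul_eq_mul]
    field_simp
  -- One-sided estimate: the majorant (or minorant) error under μ has a sign and is dropped, while
  -- under ν it is controlled by the density bound.
  have hone : ∀ ε : ℝ, (ε = 1 ∨ ε = -1) → ε * (μ.real (Set.Iic x) - ν.real (Set.Iic x)) ≤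
      1.28 / π * (∫ t in (0 : ℝ)..1, G t) + m / (2 * τ) := by
    intro ε hε
    have h1 : 0 ≤ ∫ y, ε * (selberg ε (τ * (x - y)) - heaviside (τ * (x - y))) ∂μ :=
      integral_nonneg fun y => selberg_sub_heaviside_nonneg hε _
    have h2 := hgauss ε hε
    rw [integral_const_mul, integral_sub (hsel ε hε μ) (hheav μ).1, (hheav μ).2] at h1
    rw [integral_const_mul, integral_sub (hsel ε hε ν) (hheav ν).1, (hheav ν).2] at h2
    linarith [hdiff ε hε]
  rw [abs_le]
  constructor
  · linarith [hone (-1) (.inr rfl)]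
  · linarith [hone 1 (.inl rfl)]

end Smoothing

end ColorUrn

namespace ColorUrn

/-! ### Characteristic functions of sums against the Gaussian one. -/

section CharFun

open Real

/-- Start from |exp(iz) - 1| ≤ |z| and integrate the derivative bound twice. -/
lemma norm_exp_mul_I_sub_taylor_of_nonneg {x : ℝ} (hx : 0 ≤ x) :
    ‖Complex.exp (x * Complex.I) - (1 + x * Complex.I - x ^ 2 / 2)‖ ≤ x ^ 3 / 6 := by
  have hexp : ∀ y : ℝ, HasDerivAt (fun y : ℝ => Complex.exp (y * Complex.I))
      (Complex.exp (y * Complex.I) * Complex.I) y := by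
    intro y
    have h := (Complex.ofRealCLM.hasDerivAt (x := y)).mul_const Complex.I
    simp only [Complex.ofRealCLM_apply, Complex.ofReal_one, one_mul] at h
    exact h.cexp
  have hid : ∀ y : ℝ, HasDerivAt (fun y : ℝ => (y : ℂ)) 1 y := fun y => by
    simpa using (hasDerivAt_id y).ofReal_comp
  have h1 : ∀ y : ℝ, 0 ≤ y → ‖Complex.exp (y * Complex.I) - (1 + y * Complex.I)‖ ≤ y ^ 2 / 2 := by
    intro y hy
    have hd : ∀ z : ℝ, HasDerivAt (fun z : ℝ => Complex.exp (z * Complex.I) - (1 + z * Complex.I))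
        ((Complex.exp (z * Complex.I) - 1) * Complex.I) z := by
      intro z
      refine ((hexp z).sub (((hid z).mul_const Complex.I).const_add 1)).congr_deriv ?_
      ring
    have hB : ∀ z : ℝ, HasDerivAt (fun z : ℝ => z ^ 2 / 2) z z := by
      intro z
      refine (((hasDerivAt_id z).pow 2).div_const 2).congr_deriv ?_
      simp
    refine image_norm_le_of_norm_deriv_right_le_deriv_boundary (a := 0) (b := y)
      (fun z _ => (hd z).continuousAt.continuousWithinAt) (fun z _ => (hd z).hasDerivWithinAt)
      (by simp) hB (fun z hz => ?_) (Set.right_mem_Icc.2 hy)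
    rw [norm_mul, Complex.norm_I, mul_one, mul_comm]
    simpa [abs_of_nonneg hz.1] using norm_exp_I_mul_ofReal_sub_one_le (x := z)
  have hd : ∀ z : ℝ, HasDerivAt
      (fun z : ℝ => Complex.exp (z * Complex.I) - (1 + z * Complex.I - z ^ 2 / 2))
      ((Complex.exp (z * Complex.I) - (1 + z * Complex.I)) * Complex.I) z := by
    intro z
    refine ((hexp z).sub ((((hid z).mul_const Complex.I).const_add 1).sub
      (((hid z).pow 2).div_const 2))).congr_deriv ?_
    linear_combination (z : ℂ) * Complex.I_mul_I
  have hB : ∀ z : ℝ, HasDerivAt (fun z : ℝ => z ^ 3 / 6) (z ^ 2 / 2) z := by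
    intro z
    refine (((hasDerivAt_id z).pow 3).div_const 6).congr_deriv ?_
    simp
    ring
  refine image_norm_le_of_norm_deriv_right_le_deriv_boundary (a := 0) (b := x)
    (fun z _ => (hd z).continuousAt.continuousWithinAt) (fun z _ => (hd z).hasDerivWithinAt)
    (by simp) hB (fun z hz => ?_) (Set.right_mem_Icc.2 hx)
  rw [norm_mul, Complex.norm_I, mul_one]
  exact h1 z hz.1

lemma norm_exp_mul_I_sub_taylor (x : ℝ) :
    ‖Complex.exp (x * Complex.I) - (1 + x * Complex.I - x ^ 2 / 2)‖ ≤ |x| ^ 3 / 6 := by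
  rcases le_total 0 x with h | h
  · rw [abs_of_nonneg h]
    exact norm_exp_mul_I_sub_taylor_of_nonneg h
  · have := norm_exp_mul_I_sub_taylor_of_nonneg (neg_nonneg.2 h)
    rw [abs_of_nonpos h, ← Complex.norm_conj]
    convert this using 2
    rw [map_sub, ← Complex.exp_conj]
    simp [map_ofNat (starRingEnd ℂ) 2]

lemma exp_neg_sub_le {x : ℝ} (hx : 0 ≤ x) : |exp (-x) - (1 - x)| ≤ x ^ 2 / 2 := by
  have h1 := quadratic_le_exp_of_nonneg hx
  have h2 := add_one_le_exp (-x)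
  -- Here (1 + x + x²/2)(1 - x + x²/2) = 1 + x⁴/4 ≥ 1.
  have h3 : exp (-x) ≤ 1 - x + x ^ 2 / 2 := by
    rw [exp_neg]
    refine inv_le_of_inv_le₀ (by nlinarith [sq_nonneg (x - 1)]) (le_trans ?_ h1)
    refine inv_le_of_inv_le₀ (by positivity) ?_
    rw [inv_le_iff_one_le_mul₀ (by positivity)]
    nlinarith [sq_nonneg (x ^ 2)]
  rw [abs_le]
  constructor <;> nlinarith [sq_nonneg x]

variable {ν : Measure ℝ} [IsProbabilityMeasure ν]

lemma integrable_pow_of_integrable_abs_pow_three (h3 : Integrable (fun y => |y| ^ 3) ν) :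
    Integrable (fun y => y) ν ∧ Integrable (fun y => y ^ 2) ν := by
  constructor
  · refine ((integrable_const 1).add h3).mono' (by fun_prop) (.of_forall fun y => ?_)
    simp only [Pi.add_apply, norm_eq_abs]
    nlinarith [abs_nonneg y, sq_nonneg (|y| - 1), mul_nonneg (abs_nonneg y) (sq_nonneg (|y| - 1)), sq_nonneg (|y|)]
  · refine ((integrable_const 1).add h3).mono' (by fun_prop) (.of_forall fun y => ?_)
    simp only [Pi.add_apply, norm_eq_abs, abs_pow]
    rw [← sub_nonneg]
    nlinarith [abs_nonneg y, mul_nonneg (abs_nonneg y) (sq_nonneg (|y| - 1)), sq_nonneg (|y| - 1)]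

/-- Lyapunov's inequality between the second and the third absolute moment. -/
lemma sqrt_secondMoment_pow_three_le (h3 : Integrable (fun y => |y| ^ 3) ν) :
    √(∫ y, y ^ 2 ∂ν) ^ 3 ≤ ∫ y, |y| ^ 3 ∂ν := by
  have h2 := (integrable_pow_of_integrable_abs_pow_three h3).2
  set σ := √(∫ y, y ^ 2 ∂ν) with hσ
  have hσ0 : 0 ≤ σ := sqrt_nonneg _
  have hσ2 : σ ^ 2 = ∫ y, y ^ 2 ∂ν := sq_sqrt (integral_nonneg fun y => sq_nonneg y)
  -- Pointwise, 2a³ - 3σa² + σ³ = (2a + σ)(a - σ)² ≥ 0 with a = |y|.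
  have key : ∫ y, 3 * σ * y ^ 2 ∂ν ≤ ∫ y, (2 * |y| ^ 3 + σ ^ 3) ∂ν := by
    refine integral_mono (h2.const_mul _) ((h3.const_mul 2).add (integrable_const _)) fun y => ?_
    simp only
    rw [← sq_abs y]
    nlinarith [mul_nonneg (add_nonneg (mul_nonneg zero_le_two (abs_nonneg y)) hσ0) (sq_nonneg (|y| - σ))]
  rw [integral_const_mul, integral_add (h3.const_mul 2) (integrable_const _), integral_const_mul,
    ← hσ2] at key
  simp at key
  nlinarith

lemma norm_charFun_sub_le (h3 : Integrable (fun y => |y| ^ 3) ν) (h1 : ∫ y, y ∂ν = 0) (t : ℝ) :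
    ‖charFun ν t - ((1 - (∫ y, y ^ 2 ∂ν) * t ^ 2 / 2 : ℝ) : ℂ)‖ ≤ (∫ y, |y| ^ 3 ∂ν) * |t| ^ 3 / 6 := by
  obtain ⟨hi1, hi2⟩ := integrable_pow_of_integrable_abs_pow_three h3
  have hexp : Integrable (fun y : ℝ => Complex.exp (t * y * Complex.I)) ν := by
    refine .of_bound (by fun_prop) 1 (.of_forall fun y => ?_)
    rw [← Complex.ofReal_mul, Complex.norm_exp_ofReal_mul_I]
  have hc1 : Integrable (fun y : ℝ => ((t * y : ℝ) : ℂ) * Complex.I) ν :=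
    (hi1.const_mul t).ofReal.mul_const _
  have hc2 : Integrable (fun y : ℝ => ((t ^ 2 / 2 * y ^ 2 : ℝ) : ℂ)) ν :=
    (hi2.const_mul _).ofReal
  have hc3 : Integrable (fun y : ℝ => 1 + ((t * y : ℝ) : ℂ) * Complex.I) ν :=
    (integrable_const _).add hc1
  have hpoly : ∫ y : ℝ, (1 + ((t * y : ℝ) : ℂ) * Complex.I - ((t ^ 2 / 2 * y ^ 2 : ℝ) : ℂ)) ∂ν =
      ((1 - (∫ y, y ^ 2 ∂ν) * t ^ 2 / 2 : ℝ) : ℂ) := by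
    rw [integral_sub hc3 hc2, integral_add (integrable_const _) hc1,
      integral_mul_const, integral_complex_ofReal, integral_complex_ofReal, integral_const_mul,
      integral_const_mul, h1]
    simp
    ring
  have hc4 : Integrable (fun y : ℝ =>
      1 + ((t * y : ℝ) : ℂ) * Complex.I - ((t ^ 2 / 2 * y ^ 2 : ℝ) : ℂ)) ν := hc3.sub hc2
  rw [charFun_apply_real, ← hpoly, ← integral_sub hexp hc4]
  have hbound : ∀ y : ℝ, ‖Complex.exp (t * y * Complex.I) -
      (1 + ((t * y : ℝ) : ℂ) * Complex.I - ((t ^ 2 / 2 * y ^ 2 : ℝ) : ℂ))‖ ≤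
      |t| ^ 3 / 6 * |y| ^ 3 := by
    intro y
    have := norm_exp_mul_I_sub_taylor (t * y)
    rw [abs_mul, mul_pow] at this
    refine le_trans (le_of_eq ?_) (this.trans (le_of_eq (by ring)))
    congr 1
    push_cast
    ring
  refine (norm_integral_le_of_norm_le (h3.const_mul _) (.of_forall hbound)).trans (le_of_eq ?_)
  rw [integral_const_mul]
  ring

/-- With a = √s |t| ≥ √2 > 1.4, one has a²/2 ≤ a³/2.8, and 1/2.8 = 5/14. -/
lemma mul_sq_div_two_le_of_two_le {s β t : ℝ} (hs : 0 ≤ s) (hβ : √s ^ 3 ≤ β) (h : 2 ≤ s * t ^ 2) :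
    s * t ^ 2 / 2 ≤ 5 / 14 * β * |t| ^ 3 := by
  have hσ : (√s * |t|) ^ 2 = s * t ^ 2 := by rw [mul_pow, sq_sqrt hs, sq_abs]
  have h0 : 0 ≤ √s * |t| := by positivity
  have h1 : 1.4 ≤ √s * |t| := by
    refine le_of_sq_le_sq ?_ h0
    rw [hσ]
    norm_num
    linarith
  have h2 : (√s * |t|) ^ 3 ≤ β * |t| ^ 3 := by
    rw [mul_pow]
    exact mul_le_mul_of_nonneg_right hβ (by positivity)
  rw [← hσ]
  nlinarith [mul_le_mul_of_nonneg_left h1 (sq_nonneg (√s * |t|))]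

/-- For s t² ≤ 2 the Taylor bound suffices, as 1/6 ≤ 5/14; otherwise the exponent is nonnegative and
the trivial bound 1 is enough. The resulting estimate holds for all t. -/
lemma norm_charFun_le_exp (h3 : Integrable (fun y => |y| ^ 3) ν) (h1 : ∫ y, y ∂ν = 0) (t : ℝ) :
    ‖charFun ν t‖ ≤
      exp (-(∫ y, y ^ 2 ∂ν) * t ^ 2 / 2 + 5 / 14 * (∫ y, |y| ^ 3 ∂ν) * |t| ^ 3) := by
  have hβ := sqrt_secondMoment_pow_three_le h3
  have hs : 0 ≤ ∫ y, y ^ 2 ∂ν := integral_nonneg fun y => sq_nonneg y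
  have hβ0 : 0 ≤ ∫ y, |y| ^ 3 ∂ν := integral_nonneg fun y => by positivity
  have htay := norm_charFun_sub_le h3 h1 t
  set s := ∫ y, y ^ 2 ∂ν
  set β := ∫ y, |y| ^ 3 ∂ν
  have hbt : 0 ≤ β * |t| ^ 3 := by positivity
  rcases le_total (s * t ^ 2) 2 with h | h
  · have h4 : ‖charFun ν t‖ ≤ ‖charFun ν t - ((1 - s * t ^ 2 / 2 : ℝ) : ℂ)‖
        + ‖((1 - s * t ^ 2 / 2 : ℝ) : ℂ)‖ := by
      have := norm_add_le (charFun ν t - ((1 - s * t ^ 2 / 2 : ℝ) : ℂ)) ((1 - s * t ^ 2 / 2 : ℝ) : ℂ)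
      rwa [sub_add_cancel] at this
    rw [Complex.norm_real, norm_eq_abs, abs_of_nonneg (by linarith)] at h4
    have h5 := add_one_le_exp (-s * t ^ 2 / 2 + 5 / 14 * β * |t| ^ 3)
    nlinarith
  · have h4 := mul_sq_div_two_le_of_two_le hs hβ h
    refine (norm_charFun_le_one t).trans (one_le_exp ?_)
    linarith

/-- Exchange the factors one at a time; the untouched ones are bounded by c, and dividing by c i
removes the exchanged index from the full product. -/
lemma norm_prod_sub_prod_le {ι : Type*} (s : Finset ι) (a b : ι → ℂ) (c : ι → ℝ)
    (hc : ∀ i ∈ s, 0 < c i) (ha : ∀ i ∈ s, ‖a i‖ ≤ c i) (hb : ∀ i ∈ s, ‖b i‖ ≤ c i) :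
    ‖∏ i ∈ s, a i - ∏ i ∈ s, b i‖ ≤ (∏ i ∈ s, c i) * ∑ i ∈ s, ‖a i - b i‖ / c i := by
  classical
  induction s using Finset.induction_on with
  | empty => simp
  | insert k s hk ih =>
    rw [Finset.forall_mem_insert] at hc ha hb
    have ih := ih hc.2 ha.2 hb.2
    rw [Finset.prod_insert hk, Finset.prod_insert hk, Finset.prod_insert hk, Finset.sum_insert hk]
    have hA : ‖∏ i ∈ s, a i‖ ≤ ∏ i ∈ s, c i := by
      rw [norm_prod]
      exact Finset.prod_le_prod (fun i _ => norm_nonneg _) ha.2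
    have hck := hc.1
    calc ‖a k * ∏ i ∈ s, a i - b k * ∏ i ∈ s, b i‖
        = ‖(a k - b k) * ∏ i ∈ s, a i + b k * (∏ i ∈ s, a i - ∏ i ∈ s, b i)‖ := by
          congr 1
          ring
      _ ≤ ‖a k - b k‖ * ∏ i ∈ s, c i
          + c k * ((∏ i ∈ s, c i) * ∑ i ∈ s, ‖a i - b i‖ / c i) := by
          refine (norm_add_le _ _).trans ?_
          rw [norm_mul, norm_mul]
          gcongr
          exact hb.1
      _ = _ := by
          field_simp

/-- The distance between the characteristic function of a standardized sum of independent variables,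
each of which has a small variance, and that of the standard normal law. -/
lemma norm_prod_charFun_sub_le {ι : Type*} (s : Finset ι) (ν : ι → Measure ℝ)
    [∀ i, IsProbabilityMeasure (ν i)] (h3 : ∀ i ∈ s, Integrable (fun y => |y| ^ 3) (ν i))
    (h1 : ∀ i ∈ s, ∫ y, y ∂(ν i) = 0) (hvar : ∑ i ∈ s, ∫ y, y ^ 2 ∂(ν i) = 1)
    (hsmall : ∀ i ∈ s, ∫ y, y ^ 2 ∂(ν i) ≤ 0.18) {L : ℝ} (hL : ∑ i ∈ s, ∫ y, |y| ^ 3 ∂(ν i) = L)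
    {t : ℝ} (h0 : 0 ≤ t) (ht : L * t ≤ 0.7) :
    ‖∏ i ∈ s, charFun (ν i) t - Complex.exp (-(t ^ 2) / 2)‖ ≤
      L * (exp (-0.16 * t ^ 2) * (t ^ 3 / 6 + 0.425 / 8 * t ^ 4)) := by
  set v : ι → ℝ := fun i => ∫ y, y ^ 2 ∂(ν i) with hv
  set β : ι → ℝ := fun i => ∫ y, |y| ^ 3 ∂(ν i) with hβ
  have hv0 : ∀ i, 0 ≤ v i := fun i => integral_nonneg fun y => sq_nonneg y
  have hβ0 : ∀ i, 0 ≤ β i := fun i => integral_nonneg fun y => by positivity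
  have hL0 : 0 ≤ L := hL ▸ Finset.sum_nonneg fun i _ => hβ0 i
  have hgauss : Complex.exp (-(t ^ 2) / 2) = ∏ i ∈ s, ((exp (-(v i * t ^ 2 / 2)) : ℝ) : ℂ) := by
    rw [← Complex.ofReal_prod, ← exp_sum, Finset.sum_neg_distrib, ← Finset.sum_div,
      ← Finset.sum_mul, hvar, Complex.ofReal_exp]
    congr 1
    push_cast
    ring
  -- The hypothesis L t ≤ 0.7 is tuned so that 5/14 · 0.7 = 1/4, which leaves half of the Gaussian
  -- exponent.
  have hprod : ∏ i ∈ s, exp (-v i * t ^ 2 / 2 + 5 / 14 * β i * |t| ^ 3) ≤ exp (-0.25 * t ^ 2) := by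
    rw [← exp_sum, Finset.sum_add_distrib, ← Finset.sum_div, ← Finset.sum_mul, ← Finset.sum_mul,
      Finset.sum_neg_distrib, hvar, ← Finset.mul_sum, hL, abs_of_nonneg h0]
    refine exp_le_exp.2 ?_
    nlinarith [mul_le_mul_of_nonneg_right ht (sq_nonneg t)]
  -- Removing the exchanged factor costs at most exp(v t²/2) ≤ exp(0.09 t²), since v ≤ 0.18; this
  -- gives the final rate 0.25 - 0.09 = 0.16. The number 0.425 is an upper bound for √0.18.
  have hterm : ∀ i ∈ s, ‖charFun (ν i) t - ((exp (-(v i * t ^ 2 / 2)) : ℝ) : ℂ)‖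
      / exp (-v i * t ^ 2 / 2 + 5 / 14 * β i * |t| ^ 3) ≤
      β i * ((t ^ 3 / 6 + 0.425 / 8 * t ^ 4) * exp (0.09 * t ^ 2)) := by
    intro i hi
    have hA := norm_charFun_sub_le (h3 i hi) (h1 i hi) t
    have hB := exp_neg_sub_le (x := v i * t ^ 2 / 2) (by have := hv0 i; positivity)
    have hly : √(v i) ^ 3 ≤ β i := sqrt_secondMoment_pow_three_le (h3 i hi)
    have hsq : √(v i) ≤ 0.425 := by
      rw [sqrt_le_left (by norm_num)]
      exact (hsmall i hi).trans (by norm_num)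
    have hv2 : v i ^ 2 ≤ 0.425 * β i := by
      have e : v i ^ 2 = √(v i) * √(v i) ^ 3 := by
        rw [← pow_succ', show 3 + 1 = 2 * 2 from rfl, pow_mul, sq_sqrt (hv0 i)]
      rw [e]
      exact mul_le_mul hsq hly (by positivity) (by norm_num)
    have htri : ‖charFun (ν i) t - ((exp (-(v i * t ^ 2 / 2)) : ℝ) : ℂ)‖ ≤
        β i * (t ^ 3 / 6 + 0.425 / 8 * t ^ 4) := by
      have := norm_sub_le_norm_sub_add_norm_sub (charFun (ν i) t) ((1 - v i * t ^ 2 / 2 : ℝ) : ℂ)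
        ((exp (-(v i * t ^ 2 / 2)) : ℝ) : ℂ)
      rw [← Complex.ofReal_sub, Complex.norm_real, norm_eq_abs, abs_sub_comm] at this
      rw [abs_of_nonneg h0] at hA
      have ht4 := mul_le_mul_of_nonneg_right hv2 (by positivity : 0 ≤ t ^ 4)
      change ‖charFun (ν i) t - ((1 - v i * t ^ 2 / 2 : ℝ) : ℂ)‖ ≤ β i * t ^ 3 / 6 at hA
      nlinarith
    rw [div_le_iff₀ (exp_pos _)]
    refine htri.trans ?_
    rw [mul_assoc, mul_assoc, ← exp_add]
    refine mul_le_mul_of_nonneg_left (le_mul_of_one_le_right (by positivity) (one_le_exp ?_)) (hβ0 i)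
    have := mul_le_mul_of_nonneg_right (hsmall i hi) (sq_nonneg t)
    have h5 : 0 ≤ 5 / 14 * β i * |t| ^ 3 := by have := hβ0 i; positivity
    change v i * t ^ 2 ≤ _ at this
    linarith
  rw [hgauss]
  refine (norm_prod_sub_prod_le s _ _ (fun i => exp (-v i * t ^ 2 / 2 + 5 / 14 * β i * |t| ^ 3))
    (fun i _ => exp_pos _) (fun i hi => norm_charFun_le_exp (h3 i hi) (h1 i hi) t)
    (fun i hi => ?_)).trans ?_
  · rw [Complex.norm_real, norm_eq_abs, abs_of_pos (exp_pos _)]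
    refine exp_le_exp.2 ?_
    have h5 : 0 ≤ 5 / 14 * β i * |t| ^ 3 := by have := hβ0 i; positivity
    linarith
  · calc _ ≤ exp (-0.25 * t ^ 2) *
        ∑ i ∈ s, β i * ((t ^ 3 / 6 + 0.425 / 8 * t ^ 4) * exp (0.09 * t ^ 2)) := by
          refine mul_le_mul hprod (Finset.sum_le_sum hterm)
            (Finset.sum_nonneg fun i _ => by positivity) (exp_pos _).le
      _ = L * ((exp (-0.25 * t ^ 2) * exp (0.09 * t ^ 2)) * (t ^ 3 / 6 + 0.425 / 8 * t ^ 4)) := by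
          rw [← Finset.sum_mul, hL]
          ring
      _ = _ := by
          rw [← exp_add]
          ring_nf

lemma integral_Ioi_sq_mul_exp : ∫ u in Set.Ioi (0 : ℝ), u ^ 2 * exp (-0.16 * u ^ 2) = √π / 0.256 := by
  have h := integral_rpow_mul_exp_neg_mul_rpow (p := 2) (q := 2) (b := 0.16)
    (by norm_num) (by norm_num) (by norm_num)
  have hG : Gamma ((2 + 1) / 2) = √π / 2 := by
    rw [show ((2 : ℝ) + 1) / 2 = 1 / 2 + 1 by norm_num, Gamma_add_one (by norm_num),
      Gamma_one_half_eq]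
    ring
  have hp : (0.16 : ℝ) ^ (-(2 + 1) / 2 : ℝ) = 1 / 0.064 := by
    rw [show (0.16 : ℝ) = 0.4 ^ (2 : ℝ) by norm_num, ← rpow_mul (by norm_num)]
    norm_num
  rw [hG, hp] at h
  simp only [rpow_two] at h
  rw [h]
  ring

lemma integral_Ioi_pow_three_mul_exp :
    ∫ u in Set.Ioi (0 : ℝ), u ^ 3 * exp (-0.16 * u ^ 2) = 1 / 0.0512 := by
  have h := integral_rpow_mul_exp_neg_mul_rpow (p := 2) (q := 3) (b := 0.16)
    (by norm_num) (by norm_num) (by norm_num)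
  have hG : Gamma ((3 + 1) / 2) = 1 := by
    rw [show ((3 : ℝ) + 1) / 2 = 2 by norm_num, Gamma_two]
  have hp : (0.16 : ℝ) ^ (-(3 + 1) / 2 : ℝ) = 1 / 0.0256 := by
    rw [show (0.16 : ℝ) = 0.4 ^ (2 : ℝ) by norm_num, ← rpow_mul (by norm_num)]
    norm_num
  rw [hG, hp] at h
  simp only [rpow_two, show ((3 : ℝ)) = ((3 : ℕ) : ℝ) by norm_num, rpow_natCast] at h
  rw [h]
  norm_num

lemma gaussianReal_le_smul_volume :
    gaussianReal 0 1 ≤ ENNReal.ofReal (1 / √(2 * π)) • (volume : Measure ℝ) := by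
  rw [gaussianReal_of_var_ne_zero _ one_ne_zero, ← withDensity_const]
  refine withDensity_mono (.of_forall fun x => ?_)
  rw [gaussianPDF]
  refine ENNReal.ofReal_le_ofReal ?_
  rw [gaussianPDFReal]
  simp only [NNReal.coe_one, mul_one, one_div]
  refine mul_le_of_le_one_right (by positivity) (exp_le_one_iff.2 ?_)
  have := sq_nonneg (x - 0)
  linarith

end CharFun

end ColorUrn

namespace ColorUrn

/-! ### Berry–Esseen under small variances, and the universal bound 0.55. -/

section BerryEsseen

open Real

lemma inv_sqrt_two_pi_le : 1 / √(2 * π) ≤ 0.4 := by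
  have hπ := pi_gt_d2
  rw [div_le_iff₀ (by positivity)]
  have : 2.5 ≤ √(2 * π) := le_sqrt_of_sq_le (by norm_num; linarith)
  norm_num at this ⊢
  linarith

lemma integrable_id_gaussianReal : Integrable (fun y : ℝ => y) (gaussianReal 0 1) :=
  (memLp_id_gaussianReal 1).integrable le_rfl

lemma integral_gaussian_cubic_bound {T : ℝ} (hT : 0 ≤ T) :
    T * ∫ t in (0 : ℝ)..1, exp (-0.16 * (T * t) ^ 2) * ((T * t) ^ 2 / 6 + 0.425 / 8 * (T * t) ^ 3) ≤
      √π / 1.536 + 0.425 / 0.4096 := by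
  have hi2 : IntegrableOn (fun u : ℝ => u ^ 2 * exp (-0.16 * u ^ 2)) (Set.Ioi 0) := by
    have := integrableOn_rpow_mul_exp_neg_mul_sq (b := 0.16) (by norm_num) (s := 2) (by norm_num)
    simpa only [rpow_two] using this
  have hi3 : IntegrableOn (fun u : ℝ => u ^ 3 * exp (-0.16 * u ^ 2)) (Set.Ioi 0) := by
    have := integrableOn_rpow_mul_exp_neg_mul_sq (b := 0.16) (by norm_num) (s := (3 : ℕ)) (by norm_num)
    simpa only [rpow_natCast] using this
  have hsum : ∀ u : ℝ, exp (-0.16 * u ^ 2) * (u ^ 2 / 6 + 0.425 / 8 * u ^ 3) =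
      1 / 6 * (u ^ 2 * exp (-0.16 * u ^ 2)) + 0.425 / 8 * (u ^ 3 * exp (-0.16 * u ^ 2)) :=
    fun u => by ring
  rw [← smul_eq_mul, intervalIntegral.smul_integral_comp_mul_left
    (fun u => exp (-0.16 * u ^ 2) * (u ^ 2 / 6 + 0.425 / 8 * u ^ 3)), mul_zero, mul_one,
    intervalIntegral.integral_of_le hT]
  have hI := (hi2.const_mul (1 / 6)).add (hi3.const_mul (0.425 / 8))
  calc _ ≤ ∫ u in Set.Ioi (0 : ℝ), exp (-0.16 * u ^ 2) * (u ^ 2 / 6 + 0.425 / 8 * u ^ 3) := by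
        refine setIntegral_mono_set ?_ ?_ (Set.Ioc_subset_Ioi_self.eventuallyLE)
        · simp_rw [hsum]
          exact hI
        · filter_upwards [ae_restrict_mem measurableSet_Ioi] with u hu
          have : (0 : ℝ) < u := hu
          simp only [Pi.zero_apply]
          positivity
    _ = _ := by
        simp_rw [hsum]
        rw [integral_add (hi2.const_mul _) (hi3.const_mul _), integral_const_mul, integral_const_mul,
          integral_Ioi_sq_mul_exp, integral_Ioi_pow_three_mul_exp]
        ring

/-- The **Berry–Esseen theorem** with constant `2.75` for the law `μ` of a standardized sum of
independent centred variables with laws `ν i`, none of which contributes more than `18` percent of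
the variance. -/
theorem berry_esseen_of_variance_le {ι : Type*} (s : Finset ι) (ν : ι → Measure ℝ)
    [∀ i, IsProbabilityMeasure (ν i)] (h3 : ∀ i ∈ s, Integrable (fun y => |y| ^ 3) (ν i))
    (h1 : ∀ i ∈ s, ∫ y, y ∂(ν i) = 0) (hvar : ∑ i ∈ s, ∫ y, y ^ 2 ∂(ν i) = 1)
    (hsmall : ∀ i ∈ s, ∫ y, y ^ 2 ∂(ν i) ≤ 0.18)
    (μ : Measure ℝ) [IsProbabilityMeasure μ] (hμ : Integrable (fun y => y) μ)
    (hchar : ∀ t, charFun μ t = ∏ i ∈ s, charFun (ν i) t) (x : ℝ) :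
    |μ.real (Set.Iic x) - (gaussianReal 0 1).real (Set.Iic x)| ≤
      2.75 * ∑ i ∈ s, ∫ y, |y| ^ 3 ∂(ν i) := by
  have hπ := pi_pos
  set L := ∑ i ∈ s, ∫ y, |y| ^ 3 ∂(ν i) with hL
  have hL0 : 0 < L := by
    have hnn : ∀ i ∈ s, 0 ≤ ∫ y, |y| ^ 3 ∂(ν i) := fun i _ => integral_nonneg fun y => by positivity
    refine (Finset.sum_nonneg hnn).lt_of_ne fun h0 => ?_
    have hz := (Finset.sum_eq_zero_iff_of_nonneg hnn).1 h0.symm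
    have : ∑ i ∈ s, ∫ y, y ^ 2 ∂(ν i) = 0 := by
      refine Finset.sum_eq_zero fun i hi => ?_
      have h := sqrt_secondMoment_pow_three_le (h3 i hi)
      rw [hz i hi] at h
      have h4 : √(∫ y, y ^ 2 ∂(ν i)) = 0 := by
        have := pow_eq_zero_iff (n := 3) (by norm_num) |>.1 (le_antisymm h (by positivity))
        exact this
      rw [sqrt_eq_zero (integral_nonneg fun y => sq_nonneg y)] at h4
      exact h4
    linarith
  -- The cutoff is the largest frequency allowed in `norm_prod_charFun_sub_le`; τ expresses it in
  -- the units of the smoothing inequality.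
  set T := 0.7 / L with hT
  have hT0 : 0 < T := by positivity
  set τ := T / (2 * π) with hτ
  have hτ0 : 0 < τ := by positivity
  have eτ : ∀ t, 2 * π * τ * t = T * t := fun t => by rw [hτ]; field_simp
  set G : ℝ → ℝ := fun t => L * (T * (exp (-0.16 * (T * t) ^ 2) *
    ((T * t) ^ 2 / 6 + 0.425 / 8 * (T * t) ^ 3))) with hG
  have hmain := abs_measureReal_Iic_sub_le hμ integrable_id_gaussianReal (m := 1 / √(2 * π))
    (by positivity) gaussianReal_le_smul_volume hτ0 (G := G)
    (Continuous.intervalIntegrable (by fun_prop) _ _) (fun t h0 h1' => ?_) x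
  · refine hmain.trans ?_
    have hint : ∫ t in (0 : ℝ)..1, G t ≤ L * (√π / 1.536 + 0.425 / 0.4096) := by
      rw [hG, intervalIntegral.integral_const_mul, intervalIntegral.integral_const_mul]
      exact mul_le_mul_of_nonneg_left (integral_gaussian_cubic_bound hT0.le) hL0.le
    have hsp : √π ≤ 1.7726 := by
      rw [sqrt_le_left (by norm_num)]
      have := pi_lt_d4
      norm_num at this ⊢
      linarith
    have h28 : 1.28 / π ≤ 0.4075 := by
      rw [div_le_iff₀ hπ]
      have := pi_gt_d4
      norm_num at this ⊢
      linarith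
    have hm : 1 / √(2 * π) / (2 * τ) ≤ 1.7907 * L := by
      have e : 1 / √(2 * π) / (2 * τ) = √(2 * π) / 2 / 0.7 * L := by
        have hq : √(2 * π) * √(2 * π) = 2 * π := mul_self_sqrt (by positivity)
        have hq0 : 0 < √(2 * π) := by positivity
        rw [hτ, hT]
        field_simp
        linear_combination -hq
      have hsp2 : √(2 * π) ≤ 2.50694 := by
        rw [sqrt_le_left (by norm_num)]
        have := pi_lt_d4
        norm_num at this ⊢
        linarith
      rw [e]
      refine mul_le_mul_of_nonneg_right ?_ hL0.le
      norm_num at hsp2 ⊢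
      linarith
    have hI0 : 1.28 / π * ∫ t in (0 : ℝ)..1, G t ≤ 0.4075 * (L * (1.7726 / 1.536 + 0.425 / 0.4096)) := by
      have h5 : 1.28 / π * ∫ t in (0 : ℝ)..1, G t ≤ 1.28 / π * (L * (√π / 1.536 + 0.425 / 0.4096)) :=
        mul_le_mul_of_nonneg_left hint (by positivity)
      refine h5.trans (mul_le_mul h28 ?_ (by positivity) (by norm_num))
      gcongr
    -- The Fourier integral contributes about 0.893 L and the smoothing error at most 1.7907 L,
    -- together below 2.75 L.
    norm_num at hI0 hm ⊢
    linarith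
  · rw [eτ, hchar, charFun_gaussianReal]
    have h0' : 0 ≤ T * t := by positivity
    have := norm_prod_charFun_sub_le s ν h3 h1 hvar hsmall hL.symm h0' (by
      rw [hT, ← mul_assoc, mul_div_cancel₀ _ hL0.ne']
      linarith)
    convert this using 1
    · congr 3
      push_cast
      simp
      ring
    · rw [hG]
      ring

lemma gaussianReal_real_Iic_neg (x : ℝ) :
    (gaussianReal 0 1).real (Set.Iic (-x)) = 1 - (gaussianReal 0 1).real (Set.Iic x) := by
  have h1 : (gaussianReal 0 1).real (Set.Iic (-x)) = (gaussianReal 0 1).real (Set.Ici x) := by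
    have h := gaussianReal_map_neg (μ := 0) (v := 1)
    rw [neg_zero] at h
    nth_rewrite 1 [← h]
    rw [map_measureReal_apply measurable_neg measurableSet_Iic]
    congr 1
    ext y
    simp
  have : NullSingletonClass (gaussianReal 0 1) := nullSingletonClass_gaussianReal one_ne_zero
  rw [h1, ← probReal_compl_eq_one_sub measurableSet_Iic, Set.compl_Iic,
    measureReal_congr Ioi_ae_eq_Ici.symm]

lemma gaussianReal_real_Iic_zero : (gaussianReal 0 1).real (Set.Iic 0) = 1 / 2 := by
  have := gaussianReal_real_Iic_neg 0
  rw [neg_zero] at this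
  linarith

lemma gaussianReal_real_Iic_le {x : ℝ} (hx : 0 ≤ x) :
    (gaussianReal 0 1).real (Set.Iic x) ≤ 1 / 2 + 0.4 * x := by
  have h1 : (gaussianReal 0 1).real (Set.Ioc 0 x) ≤ 0.4 * x := by
    have h2 := gaussianReal_le_smul_volume (Set.Ioc 0 x)
    rw [Measure.smul_apply, smul_eq_mul, volume_Ioc, sub_zero, ← ENNReal.ofReal_mul (by positivity)] at h2
    refine (ENNReal.toReal_le_of_le_ofReal (by positivity) h2).trans ?_
    exact mul_le_mul_of_nonneg_right inv_sqrt_two_pi_le hx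
  rw [← Set.Iic_union_Ioc_eq_Iic hx]
  exact (measureReal_union_le _ _).trans (by rw [gaussianReal_real_Iic_zero]; linarith)

/-- Cantelli's inequality, in the form of a common bound for both tails. -/
lemma measureReal_le_of_forall_mul_ge {μ : Measure ℝ} [IsProbabilityMeasure μ]
    (h2 : Integrable (fun y => y ^ 2) μ) (h1 : Integrable (fun y => y) μ)
    (hmean : ∫ y, y ∂μ = 0) (hvar : ∫ y, y ^ 2 ∂μ = 1) {x : ℝ} {A : Set ℝ} (hA : MeasurableSet A)
    (h : ∀ y ∈ A, x ^ 2 ≤ x * y) : μ.real A ≤ 1 / (1 + x ^ 2) := by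
  -- The indicator is dominated by ((1 + xy)/(1 + x²))², whose mean is 1/(1 + x²).
  have key : ∫ y, A.indicator 1 y ∂μ ≤
      ∫ y, (1 / (1 + x ^ 2) ^ 2) * (1 + (2 * x * y + x ^ 2 * y ^ 2)) ∂μ := by
    refine integral_mono ((integrable_const (1 : ℝ)).indicator hA)
      (((integrable_const _).add ((h1.const_mul _).add (h2.const_mul _))).const_mul _) fun y => ?_
    have e : (1 / (1 + x ^ 2) ^ 2) * (1 + (2 * x * y + x ^ 2 * y ^ 2)) =
      ((1 + x * y) / (1 + x ^ 2)) ^ 2 := by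
      rw [div_pow]
      ring
    simp only [e]
    by_cases hy : y ∈ A
    · rw [Set.indicator_of_mem hy, Pi.one_apply]
      have : 1 ≤ (1 + x * y) / (1 + x ^ 2) := by
        rw [le_div_iff₀ (by positivity)]
        linarith [h y hy]
      nlinarith
    · rw [Set.indicator_of_notMem hy]
      positivity
  have h12 : Integrable (fun y => 2 * x * y + x ^ 2 * y ^ 2) μ :=
    (h1.const_mul _).add (h2.const_mul _)
  rw [integral_indicator_one hA, integral_const_mul, integral_add (integrable_const _) h12,
    integral_add (h1.const_mul _) (h2.const_mul _),
    integral_const_mul, integral_const_mul, hmean, hvar] at key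
  refine key.trans (le_of_eq ?_)
  simp
  field_simp

lemma half_add_sub_le {x : ℝ} (h0 : 0 ≤ x) (h2 : x ≤ 2) :
    1 / (1 + x ^ 2) + 0.4 * x ≤ 1.05 := by
  rw [div_add' _ _ _ (by positivity), div_le_iff₀ (by positivity)]
  rcases le_total x 0.6 with h | h
  · norm_num at h ⊢
    -- Bounding 0.4x³ by 0.24x² leaves the quadratic -0.81x² + 0.4x - 0.05, with vertex near 0.2469.
    nlinarith [mul_nonneg (sq_nonneg x) (sub_nonneg.2 h), sq_nonneg (x - 0.2469)]
  · norm_num at h ⊢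
    nlinarith [mul_nonneg h0 (mul_nonneg (sub_nonneg.2 h) (sub_nonneg.2 h2))]

/-- The Kolmogorov distance of a standardized law to the standard normal law is at most `0.55`. -/
lemma abs_measureReal_Iic_sub_gaussian_le {μ : Measure ℝ} [IsProbabilityMeasure μ]
    (h2 : Integrable (fun y => y ^ 2) μ) (h1 : Integrable (fun y => y) μ)
    (hmean : ∫ y, y ∂μ = 0) (hvar : ∫ y, y ^ 2 ∂μ = 1) (x : ℝ) :
    |μ.real (Set.Iic x) - (gaussianReal 0 1).real (Set.Iic x)| ≤ 0.55 := by
  have hφ1 : ∀ y, (gaussianReal 0 1).real (Set.Iic y) ≤ 1 := fun y => measureReal_le_one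
  have hbound : ∀ y, 0 ≤ y → 1 / (1 + y ^ 2) - (1 - (gaussianReal 0 1).real (Set.Iic y)) ≤ 0.55 := by
    intro y hy
    rcases le_total y 2 with h | h
    · have := half_add_sub_le hy h
      have := gaussianReal_real_Iic_le hy
      linarith
    · have : 1 / (1 + y ^ 2) ≤ 0.55 := by
        rw [div_le_iff₀ (by positivity)]
        nlinarith
      linarith [hφ1 y]
  have hhalf : ∀ y, 0 ≤ y → 1 / 2 ≤ (gaussianReal 0 1).real (Set.Iic y) := fun y hy => by
    rw [← gaussianReal_real_Iic_zero]
    exact measureReal_mono (Set.Iic_subset_Iic.2 hy)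
  have hμ0 : 0 ≤ μ.real (Set.Iic x) := measureReal_nonneg
  have hμ1 : μ.real (Set.Iic x) ≤ 1 := measureReal_le_one
  rcases le_total 0 x with hx | hx
  · have hc := measureReal_le_of_forall_mul_ge h2 h1 hmean hvar (x := x) (measurableSet_Ioi (a := x))
      (fun y hy => by rw [sq]; exact mul_le_mul_of_nonneg_left (le_of_lt hy) hx)
    rw [← Set.compl_Iic, probReal_compl_eq_one_sub measurableSet_Iic] at hc
    have := hbound x hx
    have := hhalf x hx
    rw [abs_le]
    constructor <;> linarith
  · have hc := measureReal_le_of_forall_mul_ge h2 h1 hmean hvar (x := x) (measurableSet_Iic (a := x))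
      (fun y hy => by rw [sq]; exact mul_le_mul_of_nonpos_left hy hx)
    have hb := hbound (-x) (neg_nonneg.2 hx)
    have hh := hhalf (-x) (neg_nonneg.2 hx)
    rw [gaussianReal_real_Iic_neg] at hb hh
    rw [neg_sq] at hb
    rw [abs_le]
    constructor <;> linarith

end BerryEsseen

end ColorUrn

namespace ColorUrn

/-! ### Berry–Esseen for sums of independent random variables. -/

section BerryEsseenSum

open Real

/-- Sum the inequality 2a³ - (3/5)a² + 1/125 = (2a + 1/5)(a - 1/5)² ≥ 0 over a = √(v i); the value
1/5 is the equality case of 25 equal variances. -/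
lemma one_fifth_le_sum_of_card_le {ι : Type*} (s : Finset ι) (hs : s.card ≤ 25) {v β : ι → ℝ}
    (hv : ∀ i ∈ s, 0 ≤ v i) (hβ : ∀ i ∈ s, √(v i) ^ 3 ≤ β i) (hsum : ∑ i ∈ s, v i = 1) :
    1 / 5 ≤ ∑ i ∈ s, β i := by
  have h1 : ∑ i ∈ s, (3 / 5 * v i - 1 / 125) ≤ ∑ i ∈ s, 2 * β i := by
    refine Finset.sum_le_sum fun i hi => ?_
    have h2 := hβ i hi
    have h3 := sq_sqrt (hv i hi)
    nlinarith [mul_nonneg (add_nonneg (mul_nonneg zero_le_two (sqrt_nonneg (v i))) (by norm_num : (0 : ℝ) ≤ 1 / 5))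
      (sq_nonneg (√(v i) - 1 / 5))]
  rw [Finset.sum_sub_distrib, ← Finset.mul_sum, ← Finset.mul_sum, hsum] at h1
  simp only [Finset.sum_const, nsmul_eq_mul] at h1
  have h4 : (s.card : ℝ) ≤ 25 := by exact_mod_cast hs
  linarith

variable {Ω : Type*} [MeasurableSpace Ω] {P : Measure Ω} [IsProbabilityMeasure P]

/-- The **Berry–Esseen theorem** with constant `2.75` for sums of independent centred variables,
when there are at most `25` of them or each has at most `18` percent of the total variance. -/
theorem berry_esseen_sum {ι : Type*} [Fintype ι] {Y : ι → Ω → ℝ} (hY : ∀ i, Measurable (Y i))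
    (hind : iIndepFun Y P) (h3 : ∀ i, MemLp (Y i) 3 P) (h1 : ∀ i, ∫ ω, Y i ω ∂P = 0) {V : ℝ}
    (hV0 : 0 < V) (hV : ∑ i, ∫ ω, Y i ω ^ 2 ∂P = V)
    (hsmall : Fintype.card ι ≤ 25 ∨ ∀ i, ∫ ω, Y i ω ^ 2 ∂P ≤ 0.18 * V) (x : ℝ) :
    |P.real {ω | (∑ i, Y i ω) / √V ≤ x} - (gaussianReal 0 1).real (Set.Iic x)| ≤
      2.75 * ((∑ i, ∫ ω, |Y i ω| ^ 3 ∂P) / √V ^ 3) := by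
  set B := √V with hB
  have hB0 : 0 < B := sqrt_pos.2 hV0
  have hB2 : B ^ 2 = V := sq_sqrt hV0.le
  set X : ι → Ω → ℝ := fun i ω => Y i ω / B with hX
  have hXm : ∀ i, Measurable (X i) := fun i => (hY i).div_const B
  have hXind : iIndepFun X P := hind.comp (fun _ y => y / B) fun _ => by fun_prop
  have hX3 : ∀ i, MemLp (X i) 3 P := fun i => by
    simpa only [hX, div_eq_inv_mul] using (h3 i).const_mul B⁻¹
  have hX2 : ∀ i, MemLp (X i) 2 P := fun i => (hX3 i).mono_exponent (by norm_num)
  have hX1 : ∀ i, Integrable (X i) P := fun i => (hX3 i).integrable (by norm_num)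
  have hXmean : ∀ i, ∫ ω, X i ω ∂P = 0 := fun i => by rw [integral_div, h1, zero_div]
  have hXsq : ∀ i, ∫ ω, X i ω ^ 2 ∂P = (∫ ω, Y i ω ^ 2 ∂P) / V := fun i => by
    simp only [hX, div_pow]
    rw [integral_div, hB2]
  have hXcube : ∀ i, ∫ ω, |X i ω| ^ 3 ∂P = (∫ ω, |Y i ω| ^ 3 ∂P) / B ^ 3 := fun i => by
    simp only [hX, abs_div, div_pow, abs_of_pos hB0]
    rw [integral_div]
  have hXsum : ∑ i, ∫ ω, X i ω ^ 2 ∂P = 1 := by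
    simp_rw [hXsq]
    rw [← Finset.sum_div, hV, div_self hV0.ne']
  have hprob : ∀ i, IsProbabilityMeasure (P.map (X i)) := fun i =>
    Measure.isProbabilityMeasure_map (hXm i).aemeasurable
  have hν3 : ∀ i, Integrable (fun y => |y| ^ 3) (P.map (X i)) := fun i => by
    rw [integrable_map_measure (by fun_prop) (hXm i).aemeasurable]
    exact (hX3 i).integrable_norm_pow (by norm_num)
  have hν1 : ∀ i, ∫ y, y ∂(P.map (X i)) = 0 := fun i => by
    rw [integral_map (hXm i).aemeasurable (by fun_prop), hXmean]
  have hνsq : ∀ i, ∫ y, y ^ 2 ∂(P.map (X i)) = ∫ ω, X i ω ^ 2 ∂P := fun i =>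
    integral_map (hXm i).aemeasurable (by fun_prop)
  have hνcube : ∀ i, ∫ y, |y| ^ 3 ∂(P.map (X i)) = ∫ ω, |X i ω| ^ 3 ∂P := fun i =>
    integral_map (hXm i).aemeasurable (by fun_prop)
  have hWm : Measurable (∑ i, X i) := by fun_prop
  have hW2 : MemLp (∑ i, X i) 2 P := memLp_finsetSum' _ fun i _ => hX2 i
  set μ := P.map (∑ i, X i) with hμ
  have hμprob : IsProbabilityMeasure μ := Measure.isProbabilityMeasure_map hWm.aemeasurable
  have hWmean : ∫ ω, (∑ i, X i) ω ∂P = 0 := by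
    simp only [Finset.sum_apply]
    rw [integral_finsetSum _ fun i _ => hX1 i]
    exact Finset.sum_eq_zero fun i _ => hXmean i
  have hWvar : ∫ ω, (∑ i, X i) ω ^ 2 ∂P = 1 := by
    rw [← variance_of_integral_eq_zero hWm.aemeasurable hWmean,
      IndepFun.variance_sum (fun i _ => hX2 i) (fun i _ j _ hij => hXind.indepFun hij), ← hXsum]
    exact Finset.sum_congr rfl fun i _ => variance_of_integral_eq_zero (hXm i).aemeasurable (hXmean i)
  have hμ1 : Integrable (fun y => y) μ := by
    rw [integrable_map_measure (by fun_prop) hWm.aemeasurable]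
    exact hW2.integrable (by norm_num)
  have hset : P.real {ω | (∑ i, Y i ω) / B ≤ x} = μ.real (Set.Iic x) := by
    rw [hμ, map_measureReal_apply hWm measurableSet_Iic]
    congr 1
    ext ω
    simp [hX, Finset.sum_div]
  rw [hset, Finset.sum_div]
  simp_rw [← hXcube, ← hνcube]
  -- With few summands, 2.75 · (1/5) = 0.55 is exactly the universal bound.
  rcases hsmall with hcard | hsmall
  · have hμ2 : Integrable (fun y => y ^ 2) μ := by
      rw [integrable_map_measure (by fun_prop) hWm.aemeasurable]
      exact hW2.integrable_sq
    have h5 := one_fifth_le_sum_of_card_le Finset.univ hcard (v := fun i => ∫ y, y ^ 2 ∂(P.map (X i)))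
      (fun i _ => integral_nonneg fun y => sq_nonneg y)
      (fun i _ => sqrt_secondMoment_pow_three_le (hν3 i)) (by simp_rw [hνsq]; exact hXsum)
    have h6 := abs_measureReal_Iic_sub_gaussian_le hμ2 hμ1
      (by rw [integral_map hWm.aemeasurable (by fun_prop), hWmean])
      (by rw [integral_map hWm.aemeasurable (by fun_prop), hWvar]) x
    linarith
  · refine berry_esseen_of_variance_le Finset.univ (fun i => P.map (X i)) (fun i _ => hν3 i)
      (fun i _ => hν1 i) (by simp_rw [hνsq]; exact hXsum) (fun i _ => ?_) μ hμ1
      (fun t => ?_) x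
    · rw [hνsq, hXsq, div_le_iff₀ hV0]
      exact hsmall i
    · rw [hμ, hXind.charFun_map_sum_eq_prod fun i => (hXm i).aemeasurable, Finset.prod_apply]

end BerryEsseenSum

end ColorUrn

namespace ColorUrn

/-! ### Lazy steps and their moments. -/

section LazyStep

variable (p : PMF ℤ)

/-- The law of `I * X`, where `I` is a Bernoulli variable with success probability `q`, independent of
`X`, which has law `p`. -/
noncomputable def lazyStep (q : ℝ) : Measure ℤ :=
  ENNReal.ofReal (1 - q) • Measure.dirac 0 + ENNReal.ofReal q • p.toMeasure

variable {p}

lemma isProbabilityMeasure_lazyStep {q : ℝ} (h0 : 0 ≤ q) (h1 : q ≤ 1) :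
    IsProbabilityMeasure (lazyStep p q) := by
  constructor
  simp only [lazyStep, Measure.add_apply, Measure.smul_apply, measure_univ, smul_eq_mul, mul_one]
  rw [← ENNReal.ofReal_add (by linarith) h0]
  simp

lemma integrable_toMeasure_of_finite_support {E : Type*} [NormedAddCommGroup E]
    (hp : p.support.Finite) (f : ℤ → E) : Integrable f p.toMeasure := by
  have h : p.toMeasure.restrict p.support = p.toMeasure := by
    refine Measure.restrict_eq_self_of_ae_mem ?_
    exact (prob_compl_eq_zero_iff (.of_discrete)).2
      ((p.toMeasure_apply_eq_one_iff (.of_discrete)).2 subset_rfl)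
  rw [← h]
  exact IntegrableOn.of_finite hp

lemma integrable_lazyStep (hp : p.support.Finite) (q : ℝ) (f : ℤ → ℝ) :
    Integrable f (lazyStep p q) :=
  ((integrable_dirac (by simp)).smul_measure ENNReal.ofReal_ne_top).add_measure
    ((integrable_toMeasure_of_finite_support hp f).smul_measure ENNReal.ofReal_ne_top)

lemma integral_lazyStep {q : ℝ} (h0 : 0 ≤ q) (h1 : q ≤ 1) {f : ℤ → ℝ}
    (hf : Integrable f p.toMeasure) :
    ∫ y, f y ∂(lazyStep p q) = (1 - q) * f 0 + q * ∫ y, f y ∂p.toMeasure := by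
  rw [lazyStep, integral_add_measure ((integrable_dirac (by simp)).smul_measure ENNReal.ofReal_ne_top)
    (hf.smul_measure ENNReal.ofReal_ne_top), integral_smul_measure, integral_smul_measure,
    integral_dirac, ENNReal.toReal_ofReal (by linarith), ENNReal.toReal_ofReal h0]
  rfl

lemma integral_lazyStep_sub (hp : p.support.Finite) {q : ℝ} (h0 : 0 ≤ q) (h1 : q ≤ 1) :
    ∫ y, ((y : ℝ) - mean p * q) ∂(lazyStep p q) = 0 := by
  have hi := fun f : ℤ → ℝ => integrable_toMeasure_of_finite_support hp f
  rw [integral_lazyStep h0 h1 (hi _), integral_sub (hi _) (integrable_const _), ← mean]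
  simp
  ring

lemma integral_lazyStep_sub_sq (hp : p.support.Finite) {q : ℝ} (h0 : 0 ≤ q) (h1 : q ≤ 1) :
    ∫ y, ((y : ℝ) - mean p * q) ^ 2 ∂(lazyStep p q) = q * sigmaSq p - q ^ 2 * mean p ^ 2 := by
  have hi := fun f : ℤ → ℝ => integrable_toMeasure_of_finite_support hp f
  have e : ∫ y : ℤ, ((y : ℝ) - mean p * q) ^ 2 ∂p.toMeasure =
      sigmaSq p - 2 * (mean p * q) * mean p + (mean p * q) ^ 2 := by
    have : ∀ y : ℤ, ((y : ℝ) - mean p * q) ^ 2 =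
      (y : ℝ) ^ 2 - 2 * (mean p * q) * y + (mean p * q) ^ 2 := fun y => by ring
    simp_rw [this]
    rw [integral_add (hi _) (hi _), integral_sub (hi _) (hi _), integral_const_mul, ← mean, ← sigmaSq]
    simp
  rw [integral_lazyStep h0 h1 (hi _), e]
  simp
  ring

lemma integral_lazyStep_abs_sub_pow_three (hp : p.support.Finite) {q : ℝ} (h0 : 0 ≤ q)
    (h1 : q ≤ 1) :
    ∫ y, |(y : ℝ) - mean p * q| ^ 3 ∂(lazyStep p q) =
      q * (∫ x : ℤ, |(x : ℝ) - mean p * q| ^ 3 ∂p.toMeasure) + |mean p| ^ 3 * ((1 - q) * q ^ 3) := by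
  rw [integral_lazyStep h0 h1 (integrable_toMeasure_of_finite_support hp _)]
  simp [abs_mul, abs_of_nonneg h0]
  ring

lemma sq_mean_le_sigmaSq (hp : p.support.Finite) : mean p ^ 2 ≤ sigmaSq p := by
  have hi := fun f : ℤ → ℝ => integrable_toMeasure_of_finite_support hp f
  have h := integral_lazyStep_sub_sq hp zero_le_one le_rfl
  have h2 : 0 ≤ ∫ y, ((y : ℝ) - mean p * 1) ^ 2 ∂(lazyStep p 1) :=
    integral_nonneg fun y => sq_nonneg _
  rw [h] at h2
  linarith

lemma sigmaSq_pos (hp : p.support.Finite) (hp0 : p 0 ≠ 1) : 0 < sigmaSq p := by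
  have hi := fun f : ℤ → ℝ => integrable_toMeasure_of_finite_support hp f
  refine lt_of_le_of_ne (integral_nonneg fun y => sq_nonneg _) fun h => hp0 ?_
  have h2 := (integral_eq_zero_iff_of_nonneg (fun y : ℤ => sq_nonneg (y : ℝ)) (hi _)).1 h.symm
  have h3 : ∀ᵐ y ∂p.toMeasure, y ∈ ({0} : Set ℤ) := by
    filter_upwards [h2] with y hy
    simpa using hy
  rw [← p.toMeasure_apply_singleton 0 (.of_discrete)]
  exact (prob_compl_eq_zero_iff (.of_discrete)).1 h3

/-- Condition on the first summand z: the lazy step either stays at z or jumps by v - z. -/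
lemma conv_lazyStep_real_singleton (μ : Measure ℤ) [IsProbabilityMeasure μ] {q : ℝ} (h0 : 0 ≤ q)
    (h1 : q ≤ 1) (v : ℤ) :
    (μ ∗ lazyStep p q).real {v} = (1 - q) * μ.real {v} + q * ∫ z, (p (v - z)).toReal ∂μ := by
  have := isProbabilityMeasure_lazyStep (p := p) h0 h1
  have hind : ∀ (A : Set ℤ) (ρ : Measure ℤ) [IsFiniteMeasure ρ],
      Integrable (A.indicator (1 : ℤ → ℝ)) ρ := fun A ρ _ =>
    (integrable_const (1 : ℝ)).indicator (.of_discrete)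
  rw [← integral_indicator_one (.of_discrete), integral_conv (hind _ _)]
  have hinner : ∀ z : ℤ, ∫ y, Set.indicator {v} (1 : ℤ → ℝ) (z + y) ∂(lazyStep p q) =
      (1 - q) * Set.indicator {v} 1 z + q * (p (v - z)).toReal := by
    intro z
    have e : (fun y => Set.indicator {v} (1 : ℤ → ℝ) (z + y)) = Set.indicator {v - z} 1 := by
      ext y
      simp only [Set.indicator_apply, Set.mem_singleton_iff, eq_sub_iff_add_eq', Pi.one_apply]
    rw [integral_lazyStep h0 h1, add_zero, e, integral_indicator_one (.of_discrete), measureReal_def,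
      p.toMeasure_apply_singleton _ (.of_discrete)]
    rw [e]
    exact hind _ _
  simp_rw [hinner]
  have hi2 : Integrable (fun z => (p (v - z)).toReal) μ := by
    refine .of_bound (measurable_of_countable _).aestronglyMeasurable 1 (.of_forall fun z => ?_)
    rw [Real.norm_eq_abs, abs_of_nonneg ENNReal.toReal_nonneg]
    exact ENNReal.toReal_le_of_le_ofReal zero_le_one (by simpa using p.coe_le_one _)
  rw [integral_add ((hind _ _).const_mul _)
    (hi2.const_mul _), integral_const_mul, integral_const_mul, integral_indicator_one (.of_discrete)]

end LazyStep

/-! ### The law of the selected color as a sum of independent lazy steps. -/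

section Urn

variable {Ω : Type*} [MeasurableSpace Ω] {P : Measure Ω} {p : PMF ℤ} {U : ℕ → Ω → ℤ → ℝ}
  {Z : ℕ → Ω → ℤ} {U₀ : PMF ℤ}

lemma pmf_toReal_mem_Icc (p : PMF ℤ) (v : ℤ) : (p v).toReal ∈ Set.Icc (0 : ℝ) 1 :=
  ⟨ENNReal.toReal_nonneg, ENNReal.toReal_le_of_le_ofReal zero_le_one (by simpa using p.coe_le_one _)⟩

namespace IsUrn

lemma measurable_config (hU : IsUrn P p U₀ U Z) (n : ℕ) : Measurable (U n) := by
  refine measurable_pi_lambda _ fun v => ?_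
  induction n with
  | zero =>
    simp_rw [hU.init]
    exact measurable_const
  | succ n ih =>
    simp_rw [hU.step]
    exact ih.add ((measurable_of_countable fun z => (p (v - z)).toReal).comp (hU.measurable_color n))

lemma history_le (hU : IsUrn P p U₀ U Z) (n : ℕ) : history U n ≤ ‹MeasurableSpace Ω› :=
  iSup₂_le fun k _ => (hU.measurable_config k).comap_le

end IsUrn

variable [IsProbabilityMeasure P]

lemma integrable_pmf_comp {f : Ω → ℤ} (hf : Measurable f) (p : PMF ℤ) :
    Integrable (fun ω => (p (f ω)).toReal) P := by
  refine .of_bound ((measurable_of_countable fun v => (p v).toReal).comp hf).aestronglyMeasurable 1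
    (.of_forall fun ω => ?_)
  rw [Real.norm_eq_abs, abs_of_nonneg (pmf_toReal_mem_Icc p _).1]
  exact (pmf_toReal_mem_Icc p _).2

namespace IsUrn

lemma integrable_config (hU : IsUrn P p U₀ U Z) (n : ℕ) (v : ℤ) :
    Integrable (fun ω => U n ω v) P := by
  induction n with
  | zero =>
    simp_rw [hU.init]
    exact integrable_const _
  | succ n ih =>
    simp_rw [hU.step]
    exact ih.add (integrable_pmf_comp (measurable_const.sub (hU.measurable_color n)) p)

/-- The tower property applied to the selection rule. -/
lemma integral_config (hU : IsUrn P p U₀ U Z) (n : ℕ) (v : ℤ) :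
    ∫ ω, U n ω v ∂P = (n + 1) * (P.map (Z n)).real {v} := by
  have hm : MeasurableSet (Z n ⁻¹' {v}) := hU.measurable_color n (.of_discrete)
  have h := integral_condExp (μ := P) (f := (Z n ⁻¹' {v}).indicator (fun _ => (1 : ℝ)))
    (hU.history_le n)
  rw [integral_congr_ae (hU.select n v), integral_div, integral_indicator_const _ hm, smul_eq_mul,
    mul_one, div_eq_iff (by positivity)] at h
  rw [h, map_measureReal_apply (hU.measurable_color n) (.of_discrete)]
  ring

/-- The selected color performs a lazy step from one time to the next, in law. -/
lemma map_color_succ (hU : IsUrn P p U₀ U Z) (n : ℕ) :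
    P.map (Z (n + 1)) = P.map (Z n) ∗ lazyStep p (1 / ((n : ℝ) + 2)) := by
  have hq0 : (0 : ℝ) ≤ 1 / ((n : ℝ) + 2) := by positivity
  have hq1 : 1 / ((n : ℝ) + 2) ≤ 1 := by
    rw [div_le_one (by positivity)]
    linarith [(Nat.cast_nonneg n : (0 : ℝ) ≤ n)]
  have := isProbabilityMeasure_lazyStep (p := p) hq0 hq1
  have hZ : ∀ k, IsProbabilityMeasure (P.map (Z k)) := fun k =>
    Measure.isProbabilityMeasure_map (hU.measurable_color k).aemeasurable
  refine Measure.ext_iff_singleton.2 fun v => ?_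
  rw [← measureReal_eq_measureReal_iff, conv_lazyStep_real_singleton _ hq0 hq1,
    integral_map (hU.measurable_color n).aemeasurable
      (measurable_of_countable _).aestronglyMeasurable]
  have h1 := hU.integral_config (n + 1) v
  simp_rw [hU.step] at h1
  have hi : Integrable (fun ω => (p (v - Z n ω)).toReal) P :=
    integrable_pmf_comp (measurable_const.sub (hU.measurable_color n)) p
  rw [integral_add (hU.integrable_config n v) hi, hU.integral_config n v] at h1
  push_cast at h1
  field_simp
  linarith

lemma map_color_zero (hU : IsUrn P p (PMF.pure 0) U Z) : P.map (Z 0) = Measure.dirac 0 := by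
  have : IsProbabilityMeasure (P.map (Z 0)) :=
    Measure.isProbabilityMeasure_map (hU.measurable_color 0).aemeasurable
  refine Measure.ext_iff_singleton.2 fun v => ?_
  rw [← measureReal_eq_measureReal_iff]
  have h1 := hU.integral_config 0 v
  simp_rw [hU.init] at h1
  rw [← PMF.toMeasure_pure, measureReal_def (PMF.toMeasure _), PMF.toMeasure_apply_singleton _ _ (.of_discrete)]
  simpa using h1.symm

end IsUrn

variable (p) in
/-- The joint law of the independent lazy steps; the step with index `j` is taken with probability
`1 / (j + 1)`. -/
noncomputable def lazySteps : Measure (ℕ → ℤ) :=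
  Measure.infinitePi fun j : ℕ => lazyStep p (1 / ((j : ℝ) + 1))

lemma one_div_add_one_mem (j : ℕ) : 0 ≤ 1 / ((j : ℝ) + 1) ∧ 1 / ((j : ℝ) + 1) ≤ 1 :=
  ⟨by positivity, by rw [div_le_one (by positivity)]; linarith [(Nat.cast_nonneg j : (0 : ℝ) ≤ j)]⟩

instance (j : ℕ) : IsProbabilityMeasure (lazyStep p (1 / ((j : ℝ) + 1))) :=
  isProbabilityMeasure_lazyStep (one_div_add_one_mem j).1 (one_div_add_one_mem j).2

instance : IsProbabilityMeasure (lazySteps p) := by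
  unfold lazySteps
  infer_instance

lemma iIndepFun_lazySteps : iIndepFun (fun (j : ℕ) (ω : ℕ → ℤ) => ω j) (lazySteps p) :=
  iIndepFun_infinitePi (X := fun _ x => x) fun _ => measurable_id

lemma map_eval_lazySteps (j : ℕ) :
    (lazySteps p).map (fun ω => ω j) = lazyStep p (1 / ((j : ℝ) + 1)) :=
  Measure.infinitePi_map_eval _ j

/-- Only the law at each single time is matched, and no independence inside the urn process is used.
The sum omits the index 0, whose step would be taken with probability 1. -/
lemma IsUrn.map_color_eq (hU : IsUrn P p (PMF.pure 0) U Z) (n : ℕ) :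
    P.map (Z n) = (lazySteps p).map (fun ω => ∑ j ∈ Finset.Icc 1 n, ω j) := by
  induction n with
  | zero =>
    rw [hU.map_color_zero]
    simp [Measure.map_const]
  | succ n ih =>
    have hind := iIndepFun_lazySteps (p := p).indepFun_finsetSum_of_notMem
      (fun j => measurable_pi_apply j) (s := Finset.Icc 1 n) (i := n + 1) (by simp)
    have hm : Measurable fun ω : ℕ → ℤ => ∑ j ∈ Finset.Icc 1 n, ω j := by fun_prop
    have e : (∑ j ∈ Finset.Icc 1 n, fun ω : ℕ → ℤ => ω j) = fun ω => ∑ j ∈ Finset.Icc 1 n, ω j := by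
      ext ω
      simp
    rw [e] at hind
    have hc := hind.map_add_eq_map_conv_map hm (measurable_pi_apply (n + 1))
    rw [hU.map_color_succ, ih]
    have e2 : (fun ω : ℕ → ℤ => ∑ j ∈ Finset.Icc 1 (n + 1), ω j) =
        (fun ω => ∑ j ∈ Finset.Icc 1 n, ω j) + fun ω => ω (n + 1) := by
      ext ω
      simp [Finset.sum_Icc_succ_top]
    rw [e2, hc, map_eval_lazySteps]
    congr 3
    push_cast
    ring

end Urn

end ColorUrn

namespace ColorUrn

/-! ### Variance and third moments in terms of ρ₂ and ρ₃. -/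

section Normalization

variable (p : PMF ℤ)

/-- The variance of the sum of the first `n` lazy steps. -/
noncomputable def sumVar (n : ℕ) : ℝ :=
  ∑ j ∈ Finset.Icc 1 n, (1 / ((j : ℝ) + 1) * sigmaSq p - (1 / ((j : ℝ) + 1)) ^ 2 * mean p ^ 2)

/-- The sum of the third absolute central moments of the first `n` lazy steps. -/
noncomputable def sumThird (n : ℕ) : ℝ :=
  ∑ j ∈ Finset.Icc 1 n, ∫ y, |(y : ℝ) - mean p * (1 / ((j : ℝ) + 1))| ^ 3 ∂(lazyStep p (1 / ((j : ℝ) + 1)))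

variable {p}

lemma sumVar_eq {n : ℕ} (hn : 1 ≤ n) : sumVar p n = n * rho2 p n := by
  have : (0 : ℝ) < n := by exact_mod_cast hn
  rw [rho2, ← mul_assoc, mul_one_div_cancel this.ne', one_mul, sumVar, Finset.sum_sub_distrib,
    ← Finset.sum_mul, ← Finset.sum_mul, ← h]
  simp only [div_pow, one_pow]
  ring

lemma sumThird_eq (hp : p.support.Finite) {n : ℕ} (hn : 1 ≤ n) : sumThird p n = n * rho3 p n := by
  have : (0 : ℝ) < n := by exact_mod_cast hn
  rw [rho3, ← mul_assoc, mul_one_div_cancel this.ne', one_mul, sumThird, Finset.mul_sum,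
    ← Finset.sum_add_distrib]
  refine Finset.sum_congr rfl fun j _ => ?_
  rw [integral_lazyStep_abs_sub_pow_three hp (one_div_add_one_mem j).1 (one_div_add_one_mem j).2,
    mul_one_div]
  congr 2
  field_simp
  ring

/-- Since j ≥ 1, the success probability q is at most 1/2, so q² ≤ q/2. -/
lemma h_mul_half_le_sumVar (p : PMF ℤ) (n : ℕ) :
    h n * (sigmaSq p - mean p ^ 2 / 2) ≤ sumVar p n := by
  rw [h, sumVar, Finset.sum_mul]
  refine Finset.sum_le_sum fun j hj => ?_
  have hj1 : (1 : ℝ) ≤ j := by exact_mod_cast (Finset.mem_Icc.1 hj).1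
  have hq : 1 / ((j : ℝ) + 1) ≤ 1 / 2 := one_div_le_one_div_of_le (by norm_num) (by linarith)
  have hq0 := (one_div_add_one_mem j).1
  nlinarith [mul_nonneg (mul_nonneg hq0 (sub_nonneg.2 hq)) (sq_nonneg (mean p))]

lemma h_nonneg (n : ℕ) : 0 ≤ h n := Finset.sum_nonneg fun j _ => (one_div_add_one_mem j).1

lemma h_mono : Monotone h := fun _ _ hmn =>
  Finset.sum_le_sum_of_subset_of_nonneg (Finset.Icc_subset_Icc_right hmn)
    fun j _ _ => (one_div_add_one_mem j).1

lemma h_pos {n : ℕ} (hn : 1 ≤ n) : 0 < h n :=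
  lt_of_lt_of_le (by norm_num [h]) (h_mono hn)

lemma h_mul_sigmaSq_half_le_sumVar (hp : p.support.Finite) (n : ℕ) :
    h n * (sigmaSq p / 2) ≤ sumVar p n :=
  (mul_le_mul_of_nonneg_left (by linarith [sq_mean_le_sigmaSq hp]) (h_nonneg n)).trans
    (h_mul_half_le_sumVar p n)

lemma sumVar_pos (hp : p.support.Finite) (hp0 : p 0 ≠ 1) {n : ℕ} (hn : 1 ≤ n) : 0 < sumVar p n :=
  lt_of_lt_of_le (mul_pos (h_pos hn) (half_pos (sigmaSq_pos hp hp0)))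
    (h_mul_sigmaSq_half_le_sumVar hp n)

lemma le_h_of_lt {n : ℕ} (hn : 25 < n) : 2.8 ≤ h n := by
  refine le_trans ?_ (h_mono hn.le)
  norm_num [h, Finset.sum_Icc_succ_top]

lemma lyapunov_ratio_eq (hp : p.support.Finite) (hp0 : p 0 ≠ 1) {n : ℕ} (hn : 1 ≤ n) :
    rho3 p n / (Real.sqrt n * rho2 p n ^ (3 / 2 : ℝ)) = sumThird p n / √(sumVar p n) ^ 3 := by
  have hn0 : (0 : ℝ) < n := by exact_mod_cast hn
  have hV := sumVar_pos hp hp0 hn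
  rw [sumVar_eq hn] at hV
  have hρ : 0 < rho2 p n := (mul_pos_iff_of_pos_left hn0).1 hV
  have e : rho2 p n ^ (3 / 2 : ℝ) = √(rho2 p n) ^ 3 := by
    rw [Real.sqrt_eq_rpow, ← Real.rpow_natCast, ← Real.rpow_mul hρ.le]
    norm_num
  rw [e, sumVar_eq hn, sumThird_eq hp hn, Real.sqrt_mul hn0.le, mul_pow]
  have h1 : √(n : ℝ) ^ 3 = n * √(n : ℝ) := by
    rw [pow_succ, Real.sq_sqrt hn0.le]
  rw [h1]
  have h2 : 0 < √(n : ℝ) := Real.sqrt_pos.2 hn0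
  have h3 : 0 < √(rho2 p n) := Real.sqrt_pos.2 hρ
  field_simp

end Normalization

/-! ### The Berry–Esseen bound for the urn and its logarithmic rate. -/

section Main

variable {p : PMF ℤ}

lemma integral_eval_lazySteps (j : ℕ) (f : ℤ → ℝ) :
    ∫ ω, f (ω j) ∂(lazySteps p) = ∫ y, f y ∂(lazyStep p (1 / ((j : ℝ) + 1))) := by
  rw [← map_eval_lazySteps, integral_map (measurable_pi_apply j).aemeasurable
    (measurable_of_countable f).aestronglyMeasurable]

lemma memLp_eval_lazySteps (hp : p.support.Finite) (j : ℕ) (f : ℤ → ℝ) :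
    MemLp (fun ω => f (ω j)) 3 (lazySteps p) := by
  have hf := measurable_of_countable f
  have h1 : MemLp f 3 (lazyStep p (1 / ((j : ℝ) + 1))) := by
    rw [← integrable_norm_rpow_iff hf.aestronglyMeasurable (by norm_num) (by norm_num)]
    exact integrable_lazyStep hp _ _
  rw [← map_eval_lazySteps] at h1
  exact h1.comp_of_map (measurable_pi_apply j).aemeasurable

lemma IsUrn.measureReal_le_eq {Ω : Type*} [MeasurableSpace Ω] {P : Measure Ω}
    [IsProbabilityMeasure P] {U : ℕ → Ω → ℤ → ℝ} {Z : ℕ → Ω → ℤ}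
    (hU : IsUrn P p (PMF.pure 0) U Z) (n : ℕ) (c x : ℝ) :
    P.real {ω | ((Z n ω : ℝ) - mean p * h n) / c ≤ x} =
      (lazySteps p).real {ω | (∑ j : Finset.Icc 1 n,
        ((ω j : ℝ) - mean p * (1 / (((j : ℕ) : ℝ) + 1)))) / c ≤ x} := by
  have hm : Measurable fun ω : ℕ → ℤ => ∑ j ∈ Finset.Icc 1 n, ω j := by fun_prop
  have h1 := map_measureReal_apply (μ := P) (hU.measurable_color n)
    (.of_discrete : MeasurableSet {z : ℤ | ((z : ℝ) - mean p * h n) / c ≤ x})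
  have h2 := map_measureReal_apply (μ := lazySteps p) hm
    (.of_discrete : MeasurableSet {z : ℤ | ((z : ℝ) - mean p * h n) / c ≤ x})
  rw [hU.map_color_eq, h2] at h1
  refine h1.symm.trans ?_
  congr 1
  ext ω
  simp only [Set.mem_preimage, Set.mem_ofPred_eq]
  rw [Finset.sum_coe_sort (Finset.Icc 1 n) (fun j : ℕ => (ω j : ℝ) - mean p * (1 / ((j : ℝ) + 1))),
    Finset.sum_sub_distrib, ← Finset.mul_sum, ← h]
  push_cast
  rfl

/-- A single variance is largest at q = 1/2, where it equals half of σ² - μ²/2; the total is at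
least 2.8 times σ² - μ²/2, and 0.5/2.8 < 0.18. -/
lemma lazyStep_variance_le (hp : p.support.Finite) {n : ℕ} (hn : 25 < n) {j : ℕ} (hj : 1 ≤ j) :
    1 / ((j : ℝ) + 1) * sigmaSq p - (1 / ((j : ℝ) + 1)) ^ 2 * mean p ^ 2 ≤ 0.18 * sumVar p n := by
  have hj1 : (1 : ℝ) ≤ j := by exact_mod_cast hj
  have hq : 1 / ((j : ℝ) + 1) ≤ 1 / 2 := one_div_le_one_div_of_le (by norm_num) (by linarith)
  have hq0 := (one_div_add_one_mem j).1
  have hms := sq_mean_le_sigmaSq hp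
  have hm0 := sq_nonneg (mean p)
  have h1 := h_mul_half_le_sumVar p n
  have h2 : 2.8 * (sigmaSq p - mean p ^ 2 / 2) ≤ h n * (sigmaSq p - mean p ^ 2 / 2) :=
    mul_le_mul_of_nonneg_right (le_h_of_lt hn) (by linarith)
  generalize 1 / ((j : ℝ) + 1) = q at *
  have h3 : q * sigmaSq p - q ^ 2 * mean p ^ 2 ≤ sigmaSq p / 2 - mean p ^ 2 / 4 := by
    have h4 : (1 / 2 + q) * mean p ^ 2 ≤ sigmaSq p := by nlinarith
    -- The gap to the value at q = 1/2 factors as (1/2 - q)(σ² - (1/2 + q)μ²).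
    nlinarith [mul_nonneg (sub_nonneg.2 hq) (sub_nonneg.2 h4)]
  norm_num at h2 ⊢
  linarith

lemma IsUrn.berry_esseen {Ω : Type*} [MeasurableSpace Ω] {P : Measure Ω}
    [IsProbabilityMeasure P] {U : ℕ → Ω → ℤ → ℝ} {Z : ℕ → Ω → ℤ} (hp : p.support.Finite)
    (hp0 : p 0 ≠ 1) (hU : IsUrn P p (PMF.pure 0) U Z) {n : ℕ} (hn : 1 ≤ n) (x : ℝ) :
    |P.real {ω | ((Z n ω : ℝ) - mean p * h n) / Real.sqrt (n * rho2 p n) ≤ x}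
        - cdf (gaussianReal 0 1) x| ≤
      2.75 * (rho3 p n / (Real.sqrt n * rho2 p n ^ (3 / 2 : ℝ))) := by
  rw [lyapunov_ratio_eq hp hp0 hn, ← sumVar_eq hn, hU.measureReal_le_eq, cdf_eq_real]
  set Y : Finset.Icc 1 n → (ℕ → ℤ) → ℝ := fun j ω => (ω j : ℝ) - mean p * (1 / (((j : ℕ) : ℝ) + 1))
    with hY
  have hsq : ∀ j, ∫ ω, Y j ω ^ 2 ∂(lazySteps p) =
      1 / (((j : ℕ) : ℝ) + 1) * sigmaSq p - (1 / (((j : ℕ) : ℝ) + 1)) ^ 2 * mean p ^ 2 := fun j =>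
    (integral_eval_lazySteps j fun y => ((y : ℝ) - mean p * (1 / (((j : ℕ) : ℝ) + 1))) ^ 2).trans
      (integral_lazyStep_sub_sq hp (one_div_add_one_mem j).1 (one_div_add_one_mem j).2)
  have hthird : ∑ j, ∫ ω, |Y j ω| ^ 3 ∂(lazySteps p) = sumThird p n := by
    refine Eq.trans (Finset.sum_congr rfl fun j _ => integral_eval_lazySteps j
      fun y => |(y : ℝ) - mean p * (1 / (((j : ℕ) : ℝ) + 1))| ^ 3)
      (Finset.sum_coe_sort (Finset.Icc 1 n) fun j : ℕ => ∫ y,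
        |(y : ℝ) - mean p * (1 / ((j : ℝ) + 1))| ^ 3 ∂(lazyStep p (1 / ((j : ℝ) + 1))))
  rw [← hthird]
  refine berry_esseen_sum (Y := Y) (fun j => ?_) ?_ (fun j => ?_) (fun j => ?_)
    (sumVar_pos hp hp0 hn) ?_ ?_ x
  · exact (measurable_of_countable fun y : ℤ =>
      (y : ℝ) - mean p * (1 / (((j : ℕ) : ℝ) + 1))).comp (measurable_pi_apply (j : ℕ))
  · exact (iIndepFun_lazySteps.precomp Subtype.val_injective).comp
      (fun (j : Finset.Icc 1 n) (y : ℤ) => (y : ℝ) - mean p * (1 / (((j : ℕ) : ℝ) + 1)))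
      fun _ => measurable_of_countable _
  · exact memLp_eval_lazySteps hp j fun y => (y : ℝ) - mean p * (1 / (((j : ℕ) : ℝ) + 1))
  · exact (integral_eval_lazySteps j fun y => (y : ℝ) - mean p * (1 / (((j : ℕ) : ℝ) + 1))).trans
      (integral_lazyStep_sub hp (one_div_add_one_mem j).1 (one_div_add_one_mem j).2)
  · simp_rw [hsq]
    exact Finset.sum_coe_sort (Finset.Icc 1 n) fun j : ℕ =>
      1 / ((j : ℝ) + 1) * sigmaSq p - (1 / ((j : ℝ) + 1)) ^ 2 * mean p ^ 2
  · rcases le_or_gt n 25 with hle | hlt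
    · left
      simpa using hle
    · right
      intro j
      rw [hsq]
      exact lazyStep_variance_le hp hlt (Finset.mem_Icc.1 j.2).1

lemma sumThird_le (hp : p.support.Finite) (n : ℕ) :
    sumThird p n ≤
      h n * ((∫ x : ℤ, (|(x : ℝ)| + |mean p|) ^ 3 ∂p.toMeasure) + |mean p| ^ 3) := by
  have hi := fun f : ℤ → ℝ => integrable_toMeasure_of_finite_support hp f
  rw [sumThird, h, Finset.sum_mul]
  refine Finset.sum_le_sum fun j _ => ?_
  obtain ⟨hq0, hq1⟩ := one_div_add_one_mem j
  rw [integral_lazyStep_abs_sub_pow_three hp hq0 hq1]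
  generalize 1 / ((j : ℝ) + 1) = q at *
  rw [mul_add]
  refine add_le_add (mul_le_mul_of_nonneg_left (integral_mono (hi _) (hi _) fun x => ?_) hq0) ?_
  · refine pow_le_pow_left₀ (abs_nonneg _) ((abs_sub _ _).trans ?_) 3
    rw [abs_mul, abs_of_nonneg hq0]
    gcongr
    exact mul_le_of_le_one_right (abs_nonneg _) hq1
  · rw [mul_comm]
    refine mul_le_mul_of_nonneg_right ?_ (by positivity)
    have : q ^ 3 ≤ q := by
      calc q ^ 3 ≤ q ^ 1 := pow_le_pow_of_le_one hq0 hq1 (by norm_num)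
        _ = q := pow_one q
    nlinarith [mul_nonneg hq0 (pow_nonneg hq0 3)]

lemma h_eq_harmonic (n : ℕ) : h n = harmonic (n + 1) - 1 := by
  induction n with
  | zero => simp [h]
  | succ n ih =>
    rw [harmonic_succ, h, Finset.sum_Icc_succ_top (by omega), ← h, ih]
    push_cast
    ring

/-- The harmonic bound gives log n ≤ h n + 1, and h n ≥ 1 in this range. -/
lemma log_le_two_mul_h {n : ℕ} (hn : 25 < n) : Real.log n ≤ 2 * h n := by
  have h1 := h_eq_harmonic n
  have h2 := log_add_one_le_harmonic (n + 1)
  have h3 := le_h_of_lt hn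
  have h4 : Real.log n ≤ Real.log ((n + 1 + 1 : ℕ) : ℝ) :=
    Real.log_le_log (by exact_mod_cast (by omega : 0 < n)) (by push_cast; linarith)
  norm_num at h3
  linarith

lemma isBigO_lyapunov_ratio (hp : p.support.Finite) (hp0 : p 0 ≠ 1) :
    (fun n : ℕ => 2.75 * (rho3 p n / (Real.sqrt n * rho2 p n ^ (3 / 2 : ℝ))))
      =O[atTop] (fun n : ℕ => 1 / Real.sqrt (Real.log n)) := by
  set C := (∫ x : ℤ, (|(x : ℝ)| + |mean p|) ^ 3 ∂p.toMeasure) + |mean p| ^ 3 with hC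
  have hC0 : 0 ≤ C := add_nonneg (integral_nonneg fun x => by positivity) (by positivity)
  set s := √(sigmaSq p / 2) with hs
  have hs0 : 0 < s := Real.sqrt_pos.2 (half_pos (sigmaSq_pos hp hp0))
  refine IsBigO.of_bound (2.75 * (C / s ^ 3 * √2)) ?_
  filter_upwards [eventually_gt_atTop 25] with n hn
  have hn1 : 1 ≤ n := by omega
  have hV := sumVar_pos hp hp0 hn1
  have hT0 : 0 ≤ sumThird p n := Finset.sum_nonneg fun j _ => integral_nonneg fun y => by positivity
  have hh := h_pos hn1
  have hlog : 0 < Real.log n := Real.log_pos (by exact_mod_cast (by omega : 1 < n))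
  rw [lyapunov_ratio_eq hp hp0 hn1, Real.norm_of_nonneg (by positivity),
    Real.norm_of_nonneg (by positivity), mul_assoc, mul_assoc]
  refine mul_le_mul_of_nonneg_left ?_ (by norm_num)
  have hsq : √(h n) * s ≤ √(sumVar p n) := by
    rw [hs, ← Real.sqrt_mul hh.le]
    exact Real.sqrt_le_sqrt (h_mul_sigmaSq_half_le_sumVar hp n)
  have hsh : 0 < √(h n) := Real.sqrt_pos.2 hh
  have hsl : 0 < √(Real.log n) := Real.sqrt_pos.2 hlog
  have hlogh : √(Real.log n) ≤ √2 * √(h n) := by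
    rw [← Real.sqrt_mul zero_le_two]
    exact Real.sqrt_le_sqrt (log_le_two_mul_h hn)
  calc sumThird p n / √(sumVar p n) ^ 3 ≤ h n * C / (√(h n) * s) ^ 3 := by
        gcongr
        exact sumThird_le hp n
    _ = C / s ^ 3 * (1 / √(h n)) := by
        have e : √(h n) ^ 3 = h n * √(h n) := by rw [pow_succ, Real.sq_sqrt hh.le]
        rw [mul_pow, e]
        field_simp
    _ ≤ C / s ^ 3 * (√2 * (1 / √(Real.log n))) := by
        refine mul_le_mul_of_nonneg_left ?_ (by positivity)
        rw [mul_one_div, div_le_div_iff₀ hsh hsl]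
        linarith

end Main

end ColorUrn

theorem theorem2p1 (p : PMF ℤ) (hp : p.support.Finite) (hp0 : p 0 ≠ 1) :
    (∀ (Ω : Type*) [MeasurableSpace Ω] (P : Measure Ω) [IsProbabilityMeasure P]
        (U : ℕ → Ω → ℤ → ℝ) (Z : ℕ → Ω → ℤ),
        ColorUrn.IsUrn P p (PMF.pure 0) U Z →
        ∀ n : ℕ, 1 ≤ n →
          (⨆ x : ℝ,
            |P.real {ω | ((Z n ω : ℝ) - ColorUrn.mean p * ColorUrn.h n) /
                Real.sqrt (n * ColorUrn.rho2 p n) ≤ x} - cdf (gaussianReal 0 1) x|)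
            ≤ 2.75 * (ColorUrn.rho3 p n / (Real.sqrt n * ColorUrn.rho2 p n ^ (3 / 2 : ℝ)))) ∧
    (fun n : ℕ => 2.75 * (ColorUrn.rho3 p n / (Real.sqrt n * ColorUrn.rho2 p n ^ (3 / 2 : ℝ))))
      =O[atTop] (fun n : ℕ => 1 / Real.sqrt (Real.log n)) :=
  ⟨fun _ _ _ _ _ _ hU _ hn => ciSup_le fun x => hU.berry_esseen hp hp0 hn x,
    ColorUrn.isBigO_lyapunov_ratio hp hp0⟩
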